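/- There is an absolute constant $C>0$ such that the following holds. Let $n\ge d\ge 1$ be integers, let $\sigma\in(0,1]$ and $\delta>0$, let $\hat X\in\mathbb{R}^{n\times d}$ be a fixed matrix with spectral norm $\|\hat X\|_2\le 1$, and let $y\in\mathbb{R}^n$ be a fixed vector with $\|y\|_2=1$. Let $X=\hat X+G$, where $G\in\mathbb{R}^{n\times d}$ has i.i.d. $\mathcal N(0,\sigma^2/n)$ entries. Then, with probability at least $1-\delta$ over $G$, for every $\lambda>0$ the Lasso problem $$\min_{w\in\mathbb{R}^d}\ \tfrac12\|Xw-y\|_2^2+\lambda\|w\|_1$$ has a unique minimizer $w[\lambda]$, and the number $|\mathcal P|$ of linear segments of the regularization path $\lambda\mapsto w[\lambda]$, $\lambda\in(0,\infty)$ (the least number of intervals that cover $(0,\infty)$ and on each of which $w[\lambda]$ is an affine function of $\lambda$), satisfies $$|\mathcal P|\le C\,n^{1.1}\left(\frac{d}{\delta\sigma}\right)^6 .$$ -/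

import Mathlib

open MeasureTheory ProbabilityTheory
open scoped Matrix Matrix.Norms.L2Operator ENNReal

noncomputable section

namespace Lasso

/-- The Lasso objective `½ ‖X w - y‖₂² + lam ‖w‖₁`. -/
def objective {n d : ℕ} (X : Matrix (Fin n) (Fin d) ℝ) (y : EuclideanSpace ℝ (Fin n))
    (lam : ℝ) (w : Fin d → ℝ) : ℝ :=
  1 / 2 * ‖WithLp.toLp 2 (X *ᵥ w) - y‖ ^ 2 + lam * ∑ i, |w i|

/-- `w` is the regularization path of the Lasso for `(X, y)`: for every `lam > 0`, the vector
`w lam` is the unique minimizer of the Lasso objective. (The values of `w` outside `(0, ∞)` are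
irrelevant.) -/
def IsPath {n d : ℕ} (X : Matrix (Fin n) (Fin d) ℝ) (y : EuclideanSpace ℝ (Fin n))
    (w : ℝ → Fin d → ℝ) : Prop :=
  ∀ lam : ℝ, 0 < lam → ∀ v : Fin d → ℝ,
    (∀ v' : Fin d → ℝ, objective X y lam v ≤ objective X y lam v') ↔ v = w lam

/-- The curve `w` is linear (that is, affine in the parameter) on the set `I` of parameters. -/
def IsLinearOn {d : ℕ} (w : ℝ → Fin d → ℝ) (I : Set ℝ) : Prop :=
  ∃ a b : Fin d → ℝ, ∀ lam ∈ I, w lam = a + lam • b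

/-- `(0, ∞)` is the union of `k` intervals on each of which the curve `w` is linear. -/
def HasLinearPieces {d : ℕ} (w : ℝ → Fin d → ℝ) (k : ℕ) : Prop :=
  ∃ I : Fin k → Set ℝ, (⋃ j, I j) = Set.Ioi 0 ∧
    ∀ j, (I j).OrdConnected ∧ IsLinearOn w (I j)

/-- The number of linear segments of the curve `w` on `(0, ∞)`: the least number of intervals
that cover `(0, ∞)` and on each of which `w` is linear; `⊤` if no finite number suffices. For a
continuous piecewise linear curve this is the number of breakpoints plus one. -/
def numSegments {d : ℕ} (w : ℝ → Fin d → ℝ) : ℕ∞ :=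
  ⨅ (k : ℕ) (_ : HasLinearPieces w k), (k : ℕ∞)

/-- The law of an `n × d` matrix with i.i.d. `N(0, σ² / n)` entries. -/
def noise (n d : ℕ) (σ : ℝ) : Measure (Fin n → Fin d → ℝ) :=
  Measure.pi fun _ => Measure.pi fun _ => gaussianReal 0 (σ ^ 2 / n).toNNReal

end Lasso

end

/-! For a fixed sign pattern of `w[λ]` the KKT conditions are linear in (λ, w), so the pattern
occupies an interval of parameters on which the path is affine. It suffices to count the patterns
met at more than one λ (`numSegments_le_card`).

Put a geometric grid with J steps on [l, R]. If the columns of X are ρ-separated, the path is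
Lipschitz with constant L = d/ρ². A sign change of coordinate i between neighbouring grid points
then leaves, at one of them, an entry with 0 < |w i| ≤ bλ, where b is of order L log(R/l)/J. Such
entries are rare. By `IsKKT.leave_one_out` the i-th column x satisfies λ ≤ |x·r| ≤ λ + bλ‖x‖², where
r, the residual of the problem without column i, is independent of x. Cauchy-Schwarz gives ‖r‖ ≥ λ/R
when ‖x‖ ≤ R, so Gaussian anti-concentration bounds the probability by bR³√n/σ: λ has cancelled.
Summing over d(J+1) pairs gives an expectation bounded uniformly in J. Fatou (J → ∞) and Markov
finish the count on [l, R].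

Above R the path is zero. Below l no entry changes sign provided every |w i| exceeds L l at λ = l.
This is likely by the same leave-one-out argument, now with ‖r‖ ≥ τ, where τ bounds from below the
distance of y to the span of the other columns. The count depends on l only through log(R/l), so a
polynomially small l costs only a factor of order n^0.1/(δσ).

Column separation rests on `gaussianVec_dist_lt_le`, which gains √(n/d) over one-dimensional
anti-concentration and so cancels the 1/√n of the noise level. The bound τ comes from the same
estimate for X with one column replaced by y. -/

namespace Lasso

variable {n d : ℕ}

/-! ### Optimality conditions and existence of minimizers. -/

/-- The Karush-Kuhn-Tucker conditions for the Lasso. -/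
def IsKKT (X : Matrix (Fin n) (Fin d) ℝ) (y : Fin n → ℝ) (lam : ℝ) (w : Fin d → ℝ) : Prop :=
  ∀ i, |(Xᵀ *ᵥ (y - X *ᵥ w)) i| ≤ lam ∧ (Xᵀ *ᵥ (y - X *ᵥ w)) i * w i = lam * |w i|

lemma objective_eq (X : Matrix (Fin n) (Fin d) ℝ) (y : EuclideanSpace ℝ (Fin n))
    (lam : ℝ) (w : Fin d → ℝ) :
    objective X y lam w =
      1 / 2 * ((X *ᵥ w - y.ofLp) ⬝ᵥ (X *ᵥ w - y.ofLp)) + lam * ∑ i, |w i| := by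
  unfold objective
  rw [EuclideanSpace.norm_sq_eq]
  simp [dotProduct, sq]

lemma dotProduct_self_nonneg_real (r : Fin n → ℝ) : 0 ≤ r ⬝ᵥ r :=
  Finset.sum_nonneg fun _ _ => mul_self_nonneg _

lemma transpose_mulVec_dotProduct (X : Matrix (Fin n) (Fin d) ℝ) (r : Fin n → ℝ)
    (v : Fin d → ℝ) : (Xᵀ *ᵥ r) ⬝ᵥ v = r ⬝ᵥ (X *ᵥ v) := by
  rw [Matrix.mulVec_transpose, Matrix.dotProduct_mulVec]

lemma objective_sub (X : Matrix (Fin n) (Fin d) ℝ) (y : EuclideanSpace ℝ (Fin n))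
    (lam : ℝ) (v w : Fin d → ℝ) :
    objective X y lam v - objective X y lam w =
      1 / 2 * ((X *ᵥ (v - w)) ⬝ᵥ (X *ᵥ (v - w)))
        - (Xᵀ *ᵥ (y.ofLp - X *ᵥ w)) ⬝ᵥ (v - w) + lam * (∑ i, |v i| - ∑ i, |w i|) := by
  rw [objective_eq, objective_eq, transpose_mulVec_dotProduct, Matrix.mulVec_sub]
  generalize X *ᵥ v = a
  generalize X *ᵥ w = b
  generalize y.ofLp = c
  simp only [dotProduct_sub, sub_dotProduct]
  rw [dotProduct_comm b a, dotProduct_comm c a, dotProduct_comm c b]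
  ring

/-- The KKT conditions say that the correlation vector is a subgradient of `lam * ‖·‖₁` at `w`, so
the first-order terms of the exact expansion are nonnegative and the quadratic remainder survives.
The remainder is what yields uniqueness. -/
lemma IsKKT.objective_add_le {X : Matrix (Fin n) (Fin d) ℝ} {y : EuclideanSpace ℝ (Fin n)}
    {lam : ℝ} {w : Fin d → ℝ} (h : IsKKT X y.ofLp lam w) (v : Fin d → ℝ) :
    objective X y lam w + 1 / 2 * ((X *ᵥ (v - w)) ⬝ᵥ (X *ᵥ (v - w))) ≤ objective X y lam v := by
  have h1 := objective_sub X y lam v w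
  have h2 : (Xᵀ *ᵥ (y.ofLp - X *ᵥ w)) ⬝ᵥ (v - w) ≤ lam * (∑ i, |v i| - ∑ i, |w i|) := by
    rw [dotProduct, ← Finset.sum_sub_distrib, Finset.mul_sum]
    refine Finset.sum_le_sum fun i _ => ?_
    obtain ⟨ha, hb⟩ := h i
    set c := (Xᵀ *ᵥ (y.ofLp - X *ᵥ w)) i
    have : c * v i ≤ lam * |v i| :=
      (le_abs_self _).trans (by rw [abs_mul]; exact mul_le_mul_of_nonneg_right ha (abs_nonneg _))
    simp only [Pi.sub_apply]
    nlinarith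
  linarith

lemma nonneg_of_quadratic {a b : ℝ} (h : ∀ s : ℝ, 0 < s → s < 1 → 0 ≤ a * s ^ 2 + b * s) :
    0 ≤ b := by
  by_contra! hb
  have ha := le_abs_self a
  have ha0 := abs_nonneg a
  have hb0 : 0 < -b := by linarith
  have hpos : 0 < |a| + -b + 1 := by linarith
  set s := -b / (2 * (|a| + -b + 1)) with hs
  have hs0 : 0 < s := by positivity
  have hs1 : s < 1 := by rw [hs, div_lt_one (by positivity)]; linarith
  have := h s hs0 hs1
  have h3 : s * (2 * (|a| + -b + 1)) = -b := by rw [hs]; field_simp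
  have h4 : 0 ≤ a * s + b := by
    by_contra! hc
    nlinarith
  nlinarith

/-- Perturb one coordinate: moving `w i` by `±s` bounds the correlation by `lam`, and shrinking `w
i` by the factor `1 - s` gives complementary slackness. -/
lemma isKKT_of_forall_le {X : Matrix (Fin n) (Fin d) ℝ} {y : EuclideanSpace ℝ (Fin n)}
    {lam : ℝ} (hl : 0 < lam) {w : Fin d → ℝ} (h : ∀ v, objective X y lam w ≤ objective X y lam v) :
    IsKKT X y.ofLp lam w := by
  intro i
  set c := (Xᵀ *ᵥ (y.ofLp - X *ᵥ w)) with hc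
  set a := (X *ᵥ Pi.single i 1) ⬝ᵥ (X *ᵥ Pi.single i 1) with ha
  have key : ∀ t : ℝ, 0 ≤ 1 / 2 * t ^ 2 * a - t * c i + lam * (|w i + t| - |w i|) := by
    intro t
    have h1 := objective_sub X y lam (w + Pi.single i t) w
    have h2 := h (w + Pi.single i t)
    have h3 : (Pi.single i t : Fin d → ℝ) = t • Pi.single i 1 := by
      rw [← Pi.single_smul]; simp
    have h4 : ∑ k, |(w + Pi.single i t : Fin d → ℝ) k| - ∑ k, |w k| = |w i + t| - |w i| := by
      rw [← Finset.sum_sub_distrib, Finset.sum_eq_single i]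
      · simp
      · intro k _ hk
        simp [hk]
      · simp
    rw [h4, add_sub_cancel_left, ← hc, dotProduct_single, h3, Matrix.mulVec_smul,
      smul_dotProduct, dotProduct_smul, ← ha] at h1
    simp only [smul_eq_mul, ← h3] at h1
    linarith
  have hle : ∀ e : ℝ, |e| = 1 → e * c i ≤ lam := by
    intro e he
    have he2 : e ^ 2 = 1 := by rw [← sq_abs, he, one_pow]
    suffices 0 ≤ lam - e * c i by linarith
    refine nonneg_of_quadratic (a := 1 / 2 * a) fun s hs _ => ?_
    have h1 := key (s * e)
    have h2 : |w i + s * e| - |w i| ≤ s := by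
      have := abs_add_le (w i) (s * e)
      rw [abs_mul, he, abs_of_pos hs] at this
      linarith
    have h3 := mul_le_mul_of_nonneg_left h2 hl.le
    have h4 : (s * e) ^ 2 = s ^ 2 := by rw [mul_pow, he2, mul_one]
    rw [h4] at h1
    nlinarith
  have habs : |c i| ≤ lam := by
    rw [abs_le]
    have h1 := hle 1 (by simp)
    have h2 := hle (-1) (by simp)
    constructor <;> linarith
  refine ⟨habs, le_antisymm ?_ ?_⟩
  · exact (le_abs_self _).trans
      (by rw [abs_mul]; exact mul_le_mul_of_nonneg_right habs (abs_nonneg _))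
  · suffices 0 ≤ c i * w i - lam * |w i| by linarith
    refine nonneg_of_quadratic (a := 1 / 2 * (w i) ^ 2 * a) fun s hs hs1 => ?_
    have h1 := key (-(s * w i))
    have h2 : |w i + -(s * w i)| = (1 - s) * |w i| := by
      have h3 : w i + -(s * w i) = (1 - s) * w i := by ring
      rw [h3, abs_mul, abs_of_pos (sub_pos.2 hs1)]
    rw [h2] at h1
    nlinarith

/-- Comparison with the zero vector. This a priori bound confines minimizers to a compact set, which
later makes events about them closed. -/
lemma IsKKT.sum_abs_le {X : Matrix (Fin n) (Fin d) ℝ} {y : EuclideanSpace ℝ (Fin n)}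
    {lam : ℝ} {w : Fin d → ℝ} (h : IsKKT X y.ofLp lam w) :
    lam * ∑ i, |w i| ≤ 1 / 2 * ‖y‖ ^ 2 := by
  have h1 := h.objective_add_le 0
  have h2 : objective X y lam 0 = 1 / 2 * ‖y‖ ^ 2 := by simp [objective]
  have h3 : 0 ≤ 1 / 2 * ‖WithLp.toLp 2 (X *ᵥ w) - y‖ ^ 2 := by positivity
  have h4 : 0 ≤ (X *ᵥ (0 - w)) ⬝ᵥ (X *ᵥ (0 - w)) := dotProduct_self_nonneg_real (X *ᵥ (0 - w))
  have h5 : objective X y lam w =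
    1 / 2 * ‖WithLp.toLp 2 (X *ᵥ w) - y‖ ^ 2 + lam * ∑ i, |w i| := rfl
  linarith

lemma continuous_objective {T : Type*} [TopologicalSpace T] (y : EuclideanSpace ℝ (Fin n))
    (lam : ℝ) {f : T → Matrix (Fin n) (Fin d) ℝ} {g : T → Fin d → ℝ}
    (hf : ∀ k j, Continuous fun t => f t k j) (hg : ∀ j, Continuous fun t => g t j) :
    Continuous fun t => objective (f t) y lam (g t) := by
  have h2 : Continuous fun t =>
      1 / 2 * (∑ k, (∑ j, f t k j * g t j - y.ofLp k) * (∑ j, f t k j * g t j - y.ofLp k))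
        + lam * ∑ i, |g t i| := by
    generalize y.ofLp = z
    fun_prop
  exact h2.congr fun t => (objective_eq _ _ _ _).symm

lemma exists_isKKT (X : Matrix (Fin n) (Fin d) ℝ) (y : EuclideanSpace ℝ (Fin n))
    {lam : ℝ} (hl : 0 < lam) : ∃ w, IsKKT X y.ofLp lam w := by
  -- Outside the ball of radius `B` the penalty alone exceeds `½‖y‖²`, the objective at 0. No
  -- injectivity of `X` is used, so the lemma also applies when a column has been zeroed.
  obtain ⟨B, hB⟩ : ∃ B, B = ‖y‖ ^ 2 / (2 * lam) := ⟨_, rfl⟩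
  have hB0 : 0 ≤ B := by rw [hB]; positivity
  have hcont : Continuous fun w : Fin d → ℝ => objective X y lam w :=
    continuous_objective y lam (fun _ _ => continuous_const) continuous_apply
  obtain ⟨w, -, hw⟩ := (isCompact_closedBall (0 : Fin d → ℝ) B).exists_isMinOn
    ⟨0, Metric.mem_closedBall_self hB0⟩ hcont.continuousOn
  have hw' : ∀ v : Fin d → ℝ, ‖v‖ ≤ B → objective X y lam w ≤ objective X y lam v :=
    fun v hv => hw (mem_closedBall_zero_iff.2 hv)
  refine ⟨w, isKKT_of_forall_le hl fun v => ?_⟩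
  by_cases hv : ‖v‖ ≤ B
  · exact hw' v hv
  · refine le_trans (hw' 0 (by simpa using hB0)) ?_
    rw [pi_norm_le_iff_of_nonneg hB0] at hv
    push Not at hv
    obtain ⟨i, hi⟩ := hv
    have h2 : objective X y lam 0 = 1 / 2 * ‖y‖ ^ 2 := by simp [objective]
    have h3 : 0 ≤ 1 / 2 * ‖WithLp.toLp 2 (X *ᵥ v) - y‖ ^ 2 := by positivity
    have h5 : objective X y lam v =
      1 / 2 * ‖WithLp.toLp 2 (X *ᵥ v) - y‖ ^ 2 + lam * ∑ i, |v i| := rfl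
    have h6 : |v i| ≤ ∑ i, |v i| :=
      Finset.single_le_sum (f := fun i => |v i|) (fun _ _ => abs_nonneg _) (Finset.mem_univ i)
    have h7 : B * lam = 1 / 2 * ‖y‖ ^ 2 := by rw [hB]; field_simp
    rw [Real.norm_eq_abs] at hi
    have h8 : B * lam ≤ lam * ∑ i, |v i| := by
      rw [mul_comm]
      exact mul_le_mul_of_nonneg_left (hi.le.trans h6) hl.le
    linarith

/-! ### Separated columns: uniqueness and Lipschitz dependence on the parameter. -/

/-- A quantitative form of injectivity of `X`: each column is at distance at least `ρ` from the
span of the others. -/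
def ColSep (X : Matrix (Fin n) (Fin d) ℝ) (ρ : ℝ) : Prop :=
  ∀ (v : Fin d → ℝ) (i : Fin d), ρ ^ 2 * v i ^ 2 ≤ (X *ᵥ v) ⬝ᵥ (X *ᵥ v)

lemma ColSep.eq_zero {X : Matrix (Fin n) (Fin d) ℝ} {ρ : ℝ} (hX : ColSep X ρ) (hρ : 0 < ρ)
    {v : Fin d → ℝ} (h : (X *ᵥ v) ⬝ᵥ (X *ᵥ v) ≤ 0) : v = 0 := by
  funext i
  have h1 := (hX v i).trans h
  have h2 : 0 < ρ ^ 2 := by positivity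
  have h3 : v i ^ 2 ≤ 0 := by nlinarith
  simpa using le_antisymm h3 (sq_nonneg _)

lemma IsKKT.unique {X : Matrix (Fin n) (Fin d) ℝ} {y : EuclideanSpace ℝ (Fin n)} {ρ lam : ℝ}
    (hX : ColSep X ρ) (hρ : 0 < ρ) {v w : Fin d → ℝ}
    (hw : IsKKT X y.ofLp lam w) (hv : IsKKT X y.ofLp lam v) : v = w := by
  have h1 := hw.objective_add_le v
  have h2 := hv.objective_add_le w
  have h3 : 0 ≤ (X *ᵥ (w - v)) ⬝ᵥ (X *ᵥ (w - v)) := dotProduct_self_nonneg_real (X *ᵥ (w - v))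
  exact sub_eq_zero.1 (hX.eq_zero hρ (by linarith))

lemma isPath_iff {X : Matrix (Fin n) (Fin d) ℝ} {y : EuclideanSpace ℝ (Fin n)} {ρ : ℝ}
    (hX : ColSep X ρ) (hρ : 0 < ρ) {w : ℝ → Fin d → ℝ} :
    IsPath X y w ↔ ∀ lam, 0 < lam → IsKKT X y.ofLp lam (w lam) := by
  refine ⟨fun h lam hl => isKKT_of_forall_le hl ((h lam hl _).2 rfl), fun h lam hl v => ?_⟩
  refine ⟨fun hv => (h lam hl).unique hX hρ (isKKT_of_forall_le hl hv), ?_⟩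
  rintro rfl v'
  have h1 := (h lam hl).objective_add_le v'
  have h3 : 0 ≤ (X *ᵥ (v' - w lam)) ⬝ᵥ (X *ᵥ (v' - w lam)) := dotProduct_self_nonneg_real (X *ᵥ (v' - w lam))
  linarith

/-- Monotonicity of the ℓ¹ subgradient: subtracting the two KKT systems gives `‖X(v-w)‖² ≤ |a-b|
‖v-w‖₁`, and separation bounds each `|v k - w k|` by `‖X(v-w)‖ / ρ`. -/
lemma IsKKT.lipschitz {X : Matrix (Fin n) (Fin d) ℝ} {y : Fin n → ℝ} {ρ a b : ℝ}
    (hX : ColSep X ρ) (hρ : 0 < ρ) {v w : Fin d → ℝ}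
    (hv : IsKKT X y a v) (hw : IsKKT X y b w) (i : Fin d) :
    |v i - w i| ≤ d / ρ ^ 2 * |a - b| := by
  set Q := (X *ᵥ (v - w)) ⬝ᵥ (X *ᵥ (v - w)) with hQ
  have hQ0 : 0 ≤ Q := dotProduct_self_nonneg_real (X *ᵥ (v - w))
  have h1 : Q ≤ |a - b| * ∑ k, |v k - w k| := by
    have e : Q = (Xᵀ *ᵥ (y - X *ᵥ w) - Xᵀ *ᵥ (y - X *ᵥ v)) ⬝ᵥ (v - w) := by
      rw [← Matrix.mulVec_sub, transpose_mulVec_dotProduct, hQ]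
      congr 1
      rw [Matrix.mulVec_sub]
      abel
    rw [e, dotProduct, Finset.mul_sum]
    refine Finset.sum_le_sum fun k _ => ?_
    obtain ⟨hv1, hv2⟩ := hv k
    obtain ⟨hw1, hw2⟩ := hw k
    simp only [Pi.sub_apply]
    set p := (Xᵀ *ᵥ (y - X *ᵥ v)) k
    set q := (Xᵀ *ᵥ (y - X *ᵥ w)) k
    have h3 : q * v k ≤ b * |v k| :=
      (le_abs_self _).trans (by rw [abs_mul]; exact mul_le_mul_of_nonneg_right hw1 (abs_nonneg _))
    have h4 : p * w k ≤ a * |w k| :=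
      (le_abs_self _).trans (by rw [abs_mul]; exact mul_le_mul_of_nonneg_right hv1 (abs_nonneg _))
    have h5 : (b - a) * (|v k| - |w k|) ≤ |a - b| * |v k - w k| := by
      refine (le_abs_self _).trans ?_
      rw [abs_mul, abs_sub_comm b a]
      exact mul_le_mul_of_nonneg_left (abs_abs_sub_abs_le _ _) (abs_nonneg _)
    nlinarith
  have h2 : ∀ k, |v k - w k| ≤ √Q / ρ := by
    intro k
    rw [le_div_iff₀ hρ]
    refine Real.le_sqrt_of_sq_le ?_
    rw [mul_pow, sq_abs, mul_comm]
    exact hX (v - w) k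
  have h3 : ∑ k, |v k - w k| ≤ d * (√Q / ρ) := by
    refine (Finset.sum_le_sum fun k _ => h2 k).trans ?_
    simp
  have h4 : √Q ≤ |a - b| * (d / ρ) := by
    rcases (Real.sqrt_nonneg Q).eq_or_lt with h | h
    · rw [← h]; positivity
    · have h5 := h1.trans (mul_le_mul_of_nonneg_left h3 (abs_nonneg _))
      have h6 : √Q * √Q = Q := Real.mul_self_sqrt hQ0
      refine le_of_mul_le_mul_right ?_ h
      calc √Q * √Q = Q := h6
        _ ≤ _ := h5
        _ = _ := by ring
  refine (h2 i).trans ?_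
  calc √Q / ρ ≤ |a - b| * (d / ρ) / ρ := by gcongr
    _ = _ := by field_simp

/-! ### Leaving out one column. -/

lemma IsKKT.eq_zero_of_col_eq_zero {Z : Matrix (Fin n) (Fin d) ℝ} {y : Fin n → ℝ} {lam : ℝ}
    {i : Fin d} (hl : 0 < lam) (hZ : ∀ k, Z k i = 0) {v : Fin d → ℝ} (hv : IsKKT Z y lam v) :
    v i = 0 := by
  obtain ⟨-, h⟩ := hv i
  have : (Zᵀ *ᵥ (y - Z *ᵥ v)) i = 0 := by
    simp [Matrix.mulVec, dotProduct, hZ]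
  rw [this, zero_mul] at h
  simpa [hl.ne'] using h.symm

lemma mulVec_eq_of_apply_eq_zero {X Z : Matrix (Fin n) (Fin d) ℝ} {i : Fin d}
    (hZ : ∀ k j, j ≠ i → Z k j = X k j) {v : Fin d → ℝ} (hv : v i = 0) : Z *ᵥ v = X *ᵥ v := by
  funext k
  simp only [Matrix.mulVec, dotProduct]
  refine Finset.sum_congr rfl fun j _ => ?_
  by_cases hj : j = i
  · subst hj; simp [hv]
  · rw [hZ k j hj]

/-- Leaving out the `i`-th column changes the correlation of that column with the residual by at
most `|w i| * ‖X i‖²`. -/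
lemma IsKKT.leave_one_out {X Z : Matrix (Fin n) (Fin d) ℝ} {y : Fin n → ℝ} {lam : ℝ}
    {i : Fin d} (hl : 0 < lam) (hZ : ∀ k j, Z k j = if j = i then 0 else X k j)
    {w v : Fin d → ℝ} (hw : IsKKT X y lam w) (hv : IsKKT Z y lam v) :
    |X.col i ⬝ᵥ (y - Z *ᵥ v)| ≤ lam + |w i| * (X.col i ⬝ᵥ X.col i) ∧
      (w i ≠ 0 → lam ≤ |X.col i ⬝ᵥ (y - Z *ᵥ v)|) := by
  have hvi : v i = 0 := hv.eq_zero_of_col_eq_zero hl fun k => by simp [hZ]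
  have hZv : Z *ᵥ v = X *ᵥ v := mulVec_eq_of_apply_eq_zero (fun k j hj => by simp [hZ, hj]) hvi
  have hcol : ∀ r j, (Xᵀ *ᵥ r) j = X.col j ⬝ᵥ r := fun r j => rfl
  have hcolZ : ∀ r j, j ≠ i → (Zᵀ *ᵥ r) j = (Xᵀ *ᵥ r) j := by
    intro r j hj
    simp [Matrix.mulVec, dotProduct, hZ, hj]
  set r := y - X *ᵥ w with hr
  set r' := y - Z *ᵥ v with hr'
  set x := X.col i with hx
  have hdiff : r' - r = X *ᵥ (w - v) := by
    rw [hr, hr', hZv, Matrix.mulVec_sub]; abel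
  -- Off `i` both vectors obey the same KKT conditions, so by monotonicity those coordinates
  -- contribute at most zero; only the `i`-th term survives, where `v i = 0`.
  have h1 : (r' - r) ⬝ᵥ (r' - r) ≤ (x ⬝ᵥ r' - x ⬝ᵥ r) * w i := by
    conv_lhs => rw [hdiff, ← transpose_mulVec_dotProduct, ← hdiff, Matrix.mulVec_sub, dotProduct]
    rw [← Finset.add_sum_erase _ _ (Finset.mem_univ i)]
    have : ∑ k ∈ Finset.univ.erase i, (Xᵀ *ᵥ r' - Xᵀ *ᵥ r) k * (w - v) k ≤ 0 := by
      refine Finset.sum_nonpos fun k hk => ?_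
      have hk := Finset.ne_of_mem_erase hk
      obtain ⟨hv1, hv2⟩ := hv k
      obtain ⟨hw1, hw2⟩ := hw k
      rw [hcolZ _ _ hk] at hv1 hv2
      simp only [Pi.sub_apply]
      set p := (Xᵀ *ᵥ r') k
      set q := (Xᵀ *ᵥ r) k
      have h3 : q * v k ≤ lam * |v k| := (le_abs_self _).trans
        (by rw [abs_mul]; exact mul_le_mul_of_nonneg_right hw1 (abs_nonneg _))
      have h4 : p * w k ≤ lam * |w k| := (le_abs_self _).trans
        (by rw [abs_mul]; exact mul_le_mul_of_nonneg_right hv1 (abs_nonneg _))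
      nlinarith
    simp only [Pi.sub_apply, hvi, hcol, sub_zero] at this ⊢
    linarith
  obtain ⟨hw1, hw2⟩ := hw i
  rw [hcol, ← hx] at hw1 hw2
  have hrr : 0 ≤ (r' - r) ⬝ᵥ (r' - r) := dotProduct_self_nonneg_real (r' - r)
  have hxx : 0 ≤ x ⬝ᵥ x := dotProduct_self_nonneg_real x
  constructor
  · have hcs : (x ⬝ᵥ (r' - r)) ^ 2 ≤ (x ⬝ᵥ x) * ((r' - r) ⬝ᵥ (r' - r)) := by
      simp only [dotProduct]
      simpa [sq] using Finset.sum_mul_sq_le_sq_mul_sq Finset.univ x (r' - r)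
    rw [← dotProduct_sub] at h1
    have h2 : |x ⬝ᵥ (r' - r)| ≤ |w i| * (x ⬝ᵥ x) := by
      set z := x ⬝ᵥ (r' - r)
      have h3 : z * w i ≤ |z| * |w i| := by rw [← abs_mul]; exact le_abs_self _
      have h4 : |z| ^ 2 ≤ (x ⬝ᵥ x) * (|z| * |w i|) := by
        rw [sq_abs]
        exact hcs.trans (mul_le_mul_of_nonneg_left (h1.trans h3) hxx)
      rcases (abs_nonneg z).eq_or_lt with h | h
      · rw [← h]; positivity
      · refine le_of_mul_le_mul_left ?_ h
        nlinarith
    calc |x ⬝ᵥ r'| = |x ⬝ᵥ r + x ⬝ᵥ (r' - r)| := by rw [← dotProduct_add, add_sub_cancel]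
      _ ≤ _ := (abs_add_le _ _).trans (add_le_add hw1 h2)
  -- Since `(x·r) w i = lam |w i|` and the left side of `h1` is nonnegative, `(x·r') w i ≥ lam |w
  -- i|`.
  · intro hne
    have hpos : 0 < |w i| := abs_pos.2 hne
    refine le_of_mul_le_mul_right ?_ hpos
    rw [← abs_mul]
    refine le_trans ?_ (le_abs_self _)
    linarith [sub_mul (x ⬝ᵥ r') (x ⬝ᵥ r) (w i)]

/-! ### Sign patterns along the path. -/

/-- The set of positive parameters at which the entries of the curve `w` have the signs `p`. -/
def patternSet (w : ℝ → Fin d → ℝ) (p : Fin d → SignType) : Set ℝ :=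
  {lam | 0 < lam ∧ ∀ i, SignType.sign (w lam i) = p i}

lemma IsKKT.eq_mul_sign {X : Matrix (Fin n) (Fin d) ℝ} {y : Fin n → ℝ} {lam : ℝ} {w : Fin d → ℝ}
    (h : IsKKT X y lam w) {i : Fin d} (hi : w i ≠ 0) :
    (Xᵀ *ᵥ (y - X *ᵥ w)) i = lam * (SignType.sign (w i) : ℝ) := by
  have h1 := (h i).2
  rw [← self_mul_sign (w i), mul_comm (w i), ← mul_assoc] at h1
  exact mul_right_cancel₀ hi h1

lemma transpose_mulVec_residual_combo (X : Matrix (Fin n) (Fin d) ℝ) (y : Fin n → ℝ)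
    (u v : Fin d → ℝ) (t : ℝ) (i : Fin d) :
    (Xᵀ *ᵥ (y - X *ᵥ ((1 - t) • u + t • v))) i =
      (1 - t) * (Xᵀ *ᵥ (y - X *ᵥ u)) i + t * (Xᵀ *ᵥ (y - X *ᵥ v)) i := by
  simp only [Matrix.mulVec_sub, Matrix.mulVec_add, Matrix.mulVec_smul, Pi.sub_apply,
    Pi.add_apply, Pi.smul_apply, smul_eq_mul]
  ring

/-- With the signs fixed, the KKT conditions are linear in the pair of parameter and vector. A
convex combination of two solutions therefore solves the problem at the combined parameter, and
uniqueness identifies it with the path. -/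
lemma ordConnected_patternSet {X : Matrix (Fin n) (Fin d) ℝ} {y : EuclideanSpace ℝ (Fin n)}
    {ρ : ℝ} (hX : ColSep X ρ) (hρ : 0 < ρ) {w : ℝ → Fin d → ℝ}
    (hw : ∀ lam, 0 < lam → IsKKT X y.ofLp lam (w lam)) (p : Fin d → SignType) :
    (patternSet w p).OrdConnected := by
  rw [← convex_iff_ordConnected]
  intro a ⟨ha, hap⟩ b ⟨hb, hbp⟩ r t hr ht hrt
  obtain rfl : r = 1 - t := by linarith
  simp only [smul_eq_mul]
  have hc : 0 < (1 - t) * a + t * b := by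
    rcases ht.eq_or_lt with rfl | h
    · simpa using ha
    · have := mul_pos h hb
      have := mul_nonneg hr ha.le
      linarith
  set u := (1 - t) • w a + t • w b with hu
  have hui : ∀ i, u i = (1 - t) * w a i + t * w b i := fun i => by simp [hu]
  have hsign : ∀ i, u i = ((1 - t) * |w a i| + t * |w b i|) * (p i : ℝ) := by
    intro i
    have e1 := abs_mul_sign (w a i)
    have e2 := abs_mul_sign (w b i)
    rw [hap i] at e1
    rw [hbp i] at e2
    rw [hui]
    linear_combination -(1 - t) * e1 - t * e2
  have hpos : ∀ i, p i ≠ 0 → 0 < (1 - t) * |w a i| + t * |w b i| := by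
    intro i hi
    have h1 : 0 < |w a i| := abs_pos.2 fun h => hi (by rw [← hap i, h, sign_zero])
    have h2 : 0 < |w b i| := abs_pos.2 fun h => hi (by rw [← hbp i, h, sign_zero])
    rcases ht.eq_or_lt with rfl | h
    · simpa using h1
    · have := mul_pos h h2
      have := mul_nonneg hr h1.le
      linarith
  have hsu : ∀ i, SignType.sign (u i) = p i := by
    intro i
    by_cases hi : p i = 0
    · rw [hsign i, hi]; simp
    · rw [hsign i, sign_mul, sign_pos (hpos i hi), one_mul]
      cases h : p i <;> simp
  have hkkt : IsKKT X y.ofLp ((1 - t) * a + t * b) u := by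
    intro i
    obtain ⟨ha1, -⟩ := hw a ha i
    obtain ⟨hb1, -⟩ := hw b hb i
    rw [hu, transpose_mulVec_residual_combo]
    constructor
    · refine (abs_add_le _ _).trans ?_
      rw [abs_mul, abs_mul, abs_of_nonneg hr, abs_of_nonneg ht]
      gcongr
    · rw [← hu]
      by_cases hi : u i = 0
      · simp [hi]
      · have hpi : p i ≠ 0 := fun h => hi (by rw [hsign i, h]; simp)
        have h1 : w a i ≠ 0 := fun h => hpi (by rw [← hap i, h, sign_zero])
        have h2 : w b i ≠ 0 := fun h => hpi (by rw [← hbp i, h, sign_zero])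
        rw [(hw a ha).eq_mul_sign h1, (hw b hb).eq_mul_sign h2, hap i, hbp i,
          ← self_mul_sign (u i), hsu i]
        ring
  have : w ((1 - t) * a + t * b) = u := hkkt.unique hX hρ (hw _ hc)
  exact ⟨hc, fun i => by rw [this, hsu i]⟩

/-- The line through two points of the path is compared with a third. That point need not lie
between them, so the KKT inequalities are unavailable for the line; the equalities on the common
support suffice to show that `X` annihilates the difference. -/
lemma isLinearOn_patternSet {X : Matrix (Fin n) (Fin d) ℝ} {y : EuclideanSpace ℝ (Fin n)}
    {ρ : ℝ} (hX : ColSep X ρ) (hρ : 0 < ρ) {w : ℝ → Fin d → ℝ}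
    (hw : ∀ lam, 0 < lam → IsKKT X y.ofLp lam (w lam)) (p : Fin d → SignType) :
    IsLinearOn w (patternSet w p) := by
  by_cases hsub : (patternSet w p).Subsingleton
  · rcases hsub.eq_empty_or_singleton with h | ⟨a, h⟩
    · exact ⟨0, 0, by simp [h]⟩
    · exact ⟨w a, 0, by simp [h]⟩
  · rw [Set.not_subsingleton_iff] at hsub
    obtain ⟨a, ⟨ha, hap⟩, b, ⟨hb, hbp⟩, hab⟩ := hsub
    have hba : b - a ≠ 0 := sub_ne_zero.2 hab.symm
    refine ⟨w a - (a / (b - a)) • (w b - w a), (1 / (b - a)) • (w b - w a), ?_⟩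
    rintro c ⟨hc, hcp⟩
    set t := (c - a) / (b - a) with ht
    set u := (1 - t) • w a + t • w b with hu
    have hct : c = (1 - t) * a + t * b := by rw [ht]; field_simp; ring
    have hz : w c - u = 0 := by
      refine hX.eq_zero hρ (le_of_eq ?_)
      have e : X *ᵥ (w c - u) = (y.ofLp - X *ᵥ u) - (y.ofLp - X *ᵥ w c) := by
        rw [Matrix.mulVec_sub]; abel
      rw [← transpose_mulVec_dotProduct, e, Matrix.mulVec_sub, dotProduct]
      refine Finset.sum_eq_zero fun i _ => ?_
      rw [Pi.sub_apply, hu, transpose_mulVec_residual_combo, ← hu]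
      by_cases hpi : p i = 0
      · have h0 : ∀ l, SignType.sign (w l i) = p i → w l i = 0 := fun l h => by
          rwa [hpi, sign_eq_zero_iff] at h
        simp [hu, h0 a (hap i), h0 b (hbp i), h0 c (hcp i)]
      · have h0 : ∀ l, SignType.sign (w l i) = p i → w l i ≠ 0 := fun l h h' => hpi (by
          rw [← h, h', sign_zero])
        rw [(hw a ha).eq_mul_sign (h0 a (hap i)), (hw b hb).eq_mul_sign (h0 b (hbp i)),
          (hw c hc).eq_mul_sign (h0 c (hcp i)), hap i, hbp i, hcp i]
        have : (1 - t) * (a * (p i : ℝ)) + t * (b * (p i : ℝ)) - c * (p i : ℝ) = 0 := by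
          linear_combination -(p i : ℝ) * hct
        rw [this, zero_mul]
    rw [sub_eq_zero.1 hz, hu, ht]
    funext i
    simp only [Pi.add_apply, Pi.sub_apply, Pi.smul_apply, smul_eq_mul]
    field_simp
    ring

/-- A pattern outside `F` occurs at most once, so these patterns together occupy finitely many
parameters, whose complement is dense. The closures of the patterns in `F` thus cover the half-line,
and affinity passes to closures by continuity. -/
lemma numSegments_le_card {w : ℝ → Fin d → ℝ} (hcont : ContinuousOn w (Set.Ioi 0))
    (hord : ∀ p, (patternSet w p).OrdConnected) (hlin : ∀ p, IsLinearOn w (patternSet w p))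
    (F : Finset (Fin d → SignType))
    (hF : ∀ p, ∀ a ∈ patternSet w p, ∀ b ∈ patternSet w p, a < b → p ∈ F) :
    numSegments w ≤ F.card := by
  have hsubset : ∀ p, patternSet w p ⊆ Set.Ioi 0 := fun p x hx => hx.1
  suffices HasLinearPieces w F.card from iInf₂_le _ this
  refine ⟨fun j => closure (patternSet w (F.equivFin.symm j)) ∩ Set.Ioi 0, ?_, fun j => ⟨?_, ?_⟩⟩
  · refine Set.Subset.antisymm (Set.iUnion_subset fun j => Set.inter_subset_right) ?_
    intro x hx
    set N : Set ℝ := ⋃ p : {p // p ∉ F}, patternSet w p.1 with hN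
    have hNfin : N.Finite := by
      refine Set.finite_iUnion fun p => Set.Subsingleton.finite ?_
      intro a ha b hb
      by_contra hab
      rcases lt_or_gt_of_ne hab with h | h
      · exact p.2 (hF _ a ha b hb h)
      · exact p.2 (hF _ b hb a ha h)
    have h1 : x ∈ closure (Set.Ioi 0 ∩ Nᶜ) :=
      (hNfin.countable.dense_compl ℝ).open_subset_closure_inter isOpen_Ioi hx
    have h2 : Set.Ioi 0 ∩ Nᶜ ⊆ ⋃ j, patternSet w (F.equivFin.symm j) := by
      rintro z ⟨hz, hzN⟩
      set q : Fin d → SignType := fun i => SignType.sign (w z i) with hq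
      have hzq : z ∈ patternSet w q := ⟨hz, fun i => rfl⟩
      have hqF : q ∈ F := by
        by_contra h
        exact hzN (Set.mem_iUnion.2 ⟨⟨q, h⟩, hzq⟩)
      exact Set.mem_iUnion.2 ⟨F.equivFin ⟨q, hqF⟩, by simpa using hzq⟩
    have h3 := closure_mono h2 h1
    rw [closure_iUnion_of_finite, Set.mem_iUnion] at h3
    obtain ⟨j, hj⟩ := h3
    exact Set.mem_iUnion.2 ⟨j, hj, hx⟩
  · refine Set.OrdConnected.inter ?_ Set.ordConnected_Ioi
    rw [← convex_iff_ordConnected]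
    exact (convex_iff_ordConnected.2 (hord _)).closure
  · obtain ⟨a, b, hab⟩ := hlin (F.equivFin.symm j)
    refine ⟨a, b, ?_⟩
    exact Set.EqOn.of_subset_closure (s := patternSet w (F.equivFin.symm j))
      (g := fun lam => a + lam • b) hab
      (hcont.mono Set.inter_subset_right) (by fun_prop)
      (fun x hx => ⟨subset_closure hx, hsubset _ hx⟩) Set.inter_subset_left

/-! ### Counting sign patterns on a geometric grid. -/

lemma card_image_range_le {α : Type*} [DecidableEq α] (f : ℕ → α) (J : ℕ) :
    ((Finset.range (J + 1)).image f).card ≤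
      1 + ((Finset.range J).filter fun j => f j ≠ f (j + 1)).card := by
  induction J with
  | zero => simp
  | succ J ih =>
    rw [Finset.range_add_one (n := J + 1), Finset.image_insert, Finset.range_add_one (n := J),
      Finset.filter_insert]
    by_cases h : f J = f (J + 1)
    · rw [Finset.insert_eq_of_mem, if_neg (by simpa using h), ← Finset.range_add_one]
      · exact ih
      · rw [← h]; exact Finset.mem_image_of_mem _ (by simp)
    · rw [if_pos h, Finset.card_insert_of_notMem (s := Finset.filter _ _) (by simp),
        ← Finset.range_add_one]
      have := Finset.card_insert_le (f (J + 1)) ((Finset.range (J + 1)).image f)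
      omega

/-- The point number `j` of the grid that divides `[l, R]` geometrically into `J` steps. -/
noncomputable def grid (l R : ℝ) (J j : ℕ) : ℝ := l * Real.exp (j * (Real.log (R / l) / J))

/-- The entries of `w` that are nonzero but small at grid points. -/
noncomputable def smallEntries (w : ℝ → Fin d → ℝ) (L l R : ℝ) (J : ℕ) : Finset (Fin d × ℕ) :=
  open Classical in (Finset.univ ×ˢ Finset.range (J + 1)).filter fun q =>
    w (grid l R J q.2) q.1 ≠ 0 ∧
      |w (grid l R J q.2) q.1| ≤ L * (2 * (Real.log (R / l) / J)) * grid l R J q.2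

lemma grid_pos {l R : ℝ} (hl : 0 < l) (J j : ℕ) : 0 < grid l R J j :=
  mul_pos hl (Real.exp_pos _)

lemma abs_le_of_sign_ne {a b : ℝ} (h : SignType.sign a ≠ SignType.sign b) :
    (a ≠ 0 ∧ |a| ≤ |a - b|) ∨ (b ≠ 0 ∧ |b| ≤ |a - b|) := by
  rcases lt_trichotomy a 0 with ha | ha | ha <;> rcases lt_trichotomy b 0 with hb | hb | hb
  · simp [sign_neg ha, sign_neg hb] at h
  · simp [ha.ne, hb]
  · left; refine ⟨ha.ne, ?_⟩
    rw [abs_of_neg ha, abs_of_neg (by linarith)]; linarith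
  · simp [hb.ne, ha]
  · simp [ha, hb] at h
  · simp [hb.ne', ha]
  · left; refine ⟨ha.ne', ?_⟩
    rw [abs_of_pos ha, abs_of_pos (by linarith)]; linarith
  · simp [ha.ne', hb]
  · simp [sign_pos ha, sign_pos hb] at h

/-- An entry whose sign changes across a step is nonzero at one of the two ends and there no larger
than its variation. The factor 2 appears because a grid point can be charged by the step on either
side of it. -/
lemma card_pattern_image_le {w : ℝ → Fin d → ℝ} {L l R : ℝ} (hl : 0 < l) (hlR : l < R) (hL : 0 ≤ L)
    (hLip : ∀ a, 0 < a → ∀ b, 0 < b → ∀ i, |w a i - w b i| ≤ L * |a - b|) {J : ℕ}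
    (hJ : Real.log (R / l) ≤ J) :
    ((Finset.range (J + 1)).image
      fun j => fun i => SignType.sign (w (grid l R J j) i)).card ≤
      1 + 2 * (smallEntries w L l R J).card := by
  refine (card_image_range_le _ J).trans (Nat.add_le_add_left ?_ 1)
  set h := Real.log (R / l) / J with hh
  have hlog : 0 < Real.log (R / l) := Real.log_pos (by rwa [one_lt_div hl])
  have h0 : 0 ≤ h := by positivity
  have h1 : h ≤ 1 := div_le_one_of_le₀ hJ (by positivity)
  -- As `exp h - 1 ≤ 2h` for `0 ≤ h ≤ 1`, the gap is proportional to the grid point itself; this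
  -- factor later cancels the `1 / lam` of `noise_smallEntryEvent_le`.
  have hstep : ∀ j, |grid l R J j - grid l R J (j + 1)| ≤ 2 * h * grid l R J j := by
    intro j
    have e : grid l R J (j + 1) = grid l R J j * Real.exp h := by
      rw [grid, grid, mul_assoc, ← Real.exp_add, ← hh]
      congr 2
      push_cast
      ring
    have e2 : grid l R J j - grid l R J (j + 1) = -(grid l R J j * (Real.exp h - 1)) := by
      rw [e]; ring
    rw [e2, abs_neg, abs_mul, abs_of_pos (grid_pos hl J j), mul_comm]
    refine mul_le_mul_of_nonneg_right ?_ (grid_pos hl J j).le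
    have := Real.abs_exp_sub_one_le (x := h) (by rwa [abs_of_nonneg h0])
    rwa [abs_of_nonneg h0] at this
  have hmono : ∀ j, grid l R J j ≤ grid l R J (j + 1) := by
    intro j
    refine mul_le_mul_of_nonneg_left (Real.exp_le_exp.2 ?_) hl.le
    push_cast
    exact mul_le_mul_of_nonneg_right (by linarith) h0
  have hsub : ((Finset.range J).filter fun j =>
      (fun i => SignType.sign (w (grid l R J j) i)) ≠
        fun i => SignType.sign (w (grid l R J (j + 1)) i)) ⊆
      (smallEntries w L l R J).image (fun q => q.2) ∪
        (smallEntries w L l R J).image (fun q => q.2 - 1) := by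
    intro j hj
    obtain ⟨hjJ, hne⟩ := Finset.mem_filter.1 hj
    rw [Finset.mem_range] at hjJ
    obtain ⟨i, hi⟩ := Function.ne_iff.1 hne
    have hd := (hLip _ (grid_pos hl J j) _ (grid_pos hl J (j + 1)) i).trans
      (mul_le_mul_of_nonneg_left (hstep j) hL)
    rw [Finset.mem_union, Finset.mem_image, Finset.mem_image]
    rcases abs_le_of_sign_ne hi with ⟨hz, hs⟩ | ⟨hz, hs⟩
    · refine Or.inl ⟨(i, j), ?_, rfl⟩
      rw [smallEntries, Finset.mem_filter]
      refine ⟨by simp; omega, hz, (hs.trans hd).trans_eq ?_⟩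
      ring
    · refine Or.inr ⟨(i, j + 1), ?_, by simp⟩
      rw [smallEntries, Finset.mem_filter]
      refine ⟨by simp; omega, hz, (hs.trans hd).trans ?_⟩
      rw [← hh, ← mul_assoc]
      exact mul_le_mul_of_nonneg_left (hmono j) (by positivity)
  refine (Finset.card_le_card hsub).trans ((Finset.card_union_le _ _).trans ?_)
  rw [two_mul]
  exact add_le_add Finset.card_image_le Finset.card_image_le

open Filter in
lemma eventually_exists_grid_mem {l R a b : ℝ} (hl : 0 < l) (hla : l ≤ a) (hab : a < b)
    (hbR : b ≤ R) : ∀ᶠ J : ℕ in atTop, ∃ j ∈ Finset.range (J + 1), grid l R J j ∈ Set.Icc a b := by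
  have ha : 0 < a := hl.trans_le hla
  have hb : 0 < b := ha.trans hab
  set α := Real.log (a / l) with hα
  set β := Real.log (b / l) with hβ
  set Λ := Real.log (R / l) with hΛ
  have hαβ : α < β := Real.log_lt_log (by positivity) (by gcongr)
  have hβΛ : β ≤ Λ := Real.log_le_log (by positivity) (by gcongr)
  have hα0 : 0 ≤ α := Real.log_nonneg (by rwa [one_le_div hl])
  have hΛ0 : 0 < Λ := by linarith
  have ht : Tendsto (fun J : ℕ => Λ / J) atTop (nhds 0) := tendsto_const_div_atTop_nhds_zero_nat Λ
  filter_upwards [ht.eventually_lt_const (sub_pos.2 hαβ), eventually_gt_atTop 0] with J hJ hJ0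
  have hJ0' : (0 : ℝ) < J := by exact_mod_cast hJ0
  have hh : 0 < Λ / J := by positivity
  have h1 : α ≤ ⌈α / (Λ / J)⌉₊ * (Λ / J) := by
    rw [← div_le_iff₀ hh]; exact Nat.le_ceil _
  have h2 : ⌈α / (Λ / J)⌉₊ * (Λ / J) ≤ β := by
    have := (Nat.ceil_lt_add_one (show 0 ≤ α / (Λ / J) by positivity)).le
    calc ⌈α / (Λ / J)⌉₊ * (Λ / J) ≤ (α / (Λ / J) + 1) * (Λ / J) := by gcongr
      _ = α + Λ / J := by field_simp
      _ ≤ β := by linarith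
  refine ⟨⌈α / (Λ / J)⌉₊, ?_, ?_, ?_⟩
  · rw [Finset.mem_range, Nat.lt_succ_iff]
    have h3 : (⌈α / (Λ / J)⌉₊ : ℝ) * (Λ / J) ≤ J * (Λ / J) := by
      rw [mul_div_cancel₀ _ hJ0'.ne']
      linarith
    exact_mod_cast le_of_mul_le_mul_right h3 hh
  · have : a = l * Real.exp α := by rw [hα, Real.exp_log (by positivity)]; field_simp
    rw [this, grid]
    exact mul_le_mul_of_nonneg_left (Real.exp_le_exp.2 h1) hl.le
  · have : b = l * Real.exp β := by rw [hβ, Real.exp_log (by positivity)]; field_simp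
    rw [this, grid]
    exact mul_le_mul_of_nonneg_left (Real.exp_le_exp.2 h2) hl.le

lemma sign_eq_of_abs_sub_lt {a b : ℝ} (h : |a - b| < |b|) :
    SignType.sign a = SignType.sign b := by
  by_contra hne
  rcases lt_trichotomy b 0 with hb | hb | hb
  · rw [abs_of_neg hb, abs_lt] at h
    rw [sign_neg hb, sign_neg (by linarith)] at hne
    exact hne rfl
  · simp only [hb, abs_zero] at h
    exact absurd h (not_lt.2 (abs_nonneg _))
  · rw [abs_of_pos hb, abs_lt] at h
    rw [sign_pos hb, sign_pos (by linarith)] at hne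
    exact hne rfl

open Filter in
-- A pattern held on a nondegenerate interval inside `[l, R]` is seen by every fine enough grid;
-- below `l` the pattern is that of `l`, above `R` it is zero. Finitely many patterns are all seen
-- for large `J`, so one good large `J` suffices. This is why a frequent bound, as supplied by
-- Fatou, is enough.
lemma numSegments_le_of_frequently {w : ℝ → Fin d → ℝ} {L l R : ℝ}
    (hl : 0 < l) (hlR : l < R) (hL : 0 ≤ L)
    (hord : ∀ p, (patternSet w p).OrdConnected) (hlin : ∀ p, IsLinearOn w (patternSet w p))
    (hLip : ∀ a, 0 < a → ∀ b, 0 < b → ∀ i, |w a i - w b i| ≤ L * |a - b|)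
    (hlarge : ∀ a, R ≤ a → w a = 0) (hsmall : ∀ i, L * l < |w l i|) {K : ℕ}
    (hK : ∃ᶠ J in atTop, (smallEntries w L l R J).card ≤ K) :
    numSegments w ≤ ((1 + 2 * K : ℕ) : ℕ∞) := by
  classical
  have hcont : ContinuousOn w (Set.Ioi 0) := by
    refine continuousOn_pi.2 fun i => ?_
    refine (LipschitzOnWith.of_dist_le_mul (K := ⟨L, hL⟩) fun a ha b hb => ?_).continuousOn
    rw [Real.dist_eq, Real.dist_eq]
    exact hLip a ha b hb i
  set F : Finset (Fin d → SignType) :=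
    Finset.univ.filter fun p => ∃ a ∈ patternSet w p, ∃ b ∈ patternSet w p, a < b with hF
  have h1 : numSegments w ≤ F.card := numSegments_le_card hcont hord hlin F
    fun p a ha b hb hab => Finset.mem_filter.2 ⟨Finset.mem_univ _, a, ha, b, hb, hab⟩
  have hmem0 : ∀ J : ℕ, (0 : ℕ) ∈ Finset.range (J + 1) := fun J => by simp
  have hgrid0 : ∀ J, grid l R J 0 = l := fun J => by simp [grid]
  have h2 : ∀ p ∈ F, ∀ᶠ J : ℕ in atTop, p ∈ (Finset.range (J + 1)).image
      fun j => fun i => SignType.sign (w (grid l R J j) i) := by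
    intro p hp
    obtain ⟨-, a, ha, b, hb, hab⟩ := Finset.mem_filter.1 hp
    by_cases hal : a < l
    · refine Eventually.of_forall fun J => Finset.mem_image.2 ⟨0, hmem0 J, funext fun i => ?_⟩
      rw [hgrid0, ← ha.2 i]
      refine (sign_eq_of_abs_sub_lt (lt_of_le_of_lt (hLip a ha.1 l hl i) ?_)).symm
      refine lt_of_le_of_lt (mul_le_mul_of_nonneg_left ?_ hL) (hsmall i)
      rw [abs_sub_comm, abs_of_pos (by linarith)]
      linarith [ha.1]
    · by_cases hRa : R ≤ a
      · filter_upwards [eventually_gt_atTop 0] with J hJ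
        refine Finset.mem_image.2 ⟨J, by simp, funext fun i => ?_⟩
        have hJ' : (J : ℝ) ≠ 0 := by exact_mod_cast hJ.ne'
        have hR : 0 < R := hl.trans hlR
        have e : grid l R J J = R := by
          rw [grid, mul_div_cancel₀ _ hJ', Real.exp_log (by positivity)]
          field_simp
        rw [e, hlarge R le_rfl, ← ha.2 i, hlarge a hRa]
      · push Not at hal hRa
        filter_upwards [eventually_exists_grid_mem hl hal (lt_min hab hRa) (min_le_right b R)]
          with J hJ
        obtain ⟨j, hj, hja, hjb⟩ := hJ
        refine Finset.mem_image.2 ⟨j, hj, funext fun i => ?_⟩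
        exact ((hord p).out ha hb ⟨hja, hjb.trans (min_le_left _ _)⟩).2 i
  have h3 : ∀ᶠ J : ℕ in atTop, F ⊆ (Finset.range (J + 1)).image
      fun j => fun i => SignType.sign (w (grid l R J j) i) := by
    filter_upwards [(Filter.eventually_all_finset F).2 h2] with J hJ p hp using hJ p hp
  have h4 : ∀ᶠ J : ℕ in atTop, Real.log (R / l) ≤ J :=
    tendsto_natCast_atTop_atTop.eventually_ge_atTop _
  obtain ⟨J, hJK, hJF, hJl⟩ := (hK.and_eventually (h3.and h4)).exists
  refine h1.trans ?_
  have h5 := Finset.card_le_card hJF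
  have h6 := card_pattern_image_le hl hlR hL hLip hJl
  exact_mod_cast (h5.trans h6).trans (by omega)

/-! ### Anti-concentration of Gaussian vectors. -/

/-- The law of a vector with `n` i.i.d. centred Gaussian entries of variance `v`. -/
noncomputable def gaussianVec (n : ℕ) (v : NNReal) : Measure (Fin n → ℝ) :=
  Measure.pi fun _ => gaussianReal 0 v

instance (n : ℕ) (v : NNReal) : IsProbabilityMeasure (gaussianVec n v) := by
  unfold gaussianVec; infer_instance

instance (n d : ℕ) (σ : ℝ) : IsProbabilityMeasure (noise n d σ) := by
  unfold noise; infer_instance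

lemma gaussianReal_Icc_le {s : NNReal} (hs : s ≠ 0) (a b : ℝ) :
    gaussianReal 0 s (Set.Icc a b) ≤ ENNReal.ofReal ((b - a) / (2 * √(s : ℝ))) := by
  have hs0 : (0 : ℝ) < s := by positivity
  rw [gaussianReal_apply 0 hs]
  have hpdf : ∀ x, gaussianPDF 0 s x ≤ ENNReal.ofReal (1 / (2 * √(s : ℝ))) := by
    intro x
    refine ENNReal.ofReal_le_ofReal ?_
    rw [gaussianPDFReal_def, one_div]
    have h1 : Real.exp (-(x - 0) ^ 2 / (2 * (s : ℝ))) ≤ 1 := by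
      rw [Real.exp_le_one_iff]
      exact div_nonpos_of_nonpos_of_nonneg (by nlinarith [sq_nonneg (x - 0)]) (by positivity)
    have h2 : 2 * √(s : ℝ) ≤ √(2 * Real.pi * s) := by
      refine Real.le_sqrt_of_sq_le ?_
      rw [mul_pow, Real.sq_sqrt hs0.le]
      nlinarith [Real.pi_gt_three]
    calc _ ≤ (√(2 * Real.pi * s))⁻¹ * 1 := mul_le_mul_of_nonneg_left h1 (by positivity)
      _ ≤ _ := by rw [mul_one]; exact inv_anti₀ (by positivity) h2
  calc ∫⁻ x in Set.Icc a b, gaussianPDF 0 s x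
      ≤ ∫⁻ _ in Set.Icc a b, ENNReal.ofReal (1 / (2 * √(s : ℝ))) := lintegral_mono hpdf
    _ = ENNReal.ofReal (1 / (2 * √(s : ℝ))) * ENNReal.ofReal (b - a) := by
        rw [setLIntegral_const, Real.volume_Icc]
    _ = _ := by
        rw [← ENNReal.ofReal_mul (by positivity)]
        congr 1; ring

lemma gaussianVec_map_dotProduct (v : NNReal) (u : Fin n → ℝ) :
    (gaussianVec n v).map (fun x => u ⬝ᵥ x) = gaussianReal 0 (v * (u ⬝ᵥ u).toNNReal) := by
  have huu : 0 ≤ u ⬝ᵥ u := dotProduct_self_nonneg_real u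
  have h1 : MeasurePreserving (fun (x : Fin n → ℝ) k => u k * x k) (gaussianVec n v)
      (Measure.pi fun k => gaussianReal 0 (NNReal.mk (u k ^ 2) (sq_nonneg _) * v)) :=
    measurePreserving_pi _ _ fun k =>
      ⟨measurable_const_mul _, by rw [gaussianReal_map_const_mul, mul_zero]⟩
  have h2 : (gaussianVec n v).map (fun x => u ⬝ᵥ x) =
      (Measure.pi fun k => gaussianReal 0 (NNReal.mk (u k ^ 2) (sq_nonneg _) * v)).map
        (fun p : Fin n → ℝ => ∑ k, p k) := by
    rw [← h1.map_eq, Measure.map_map (by fun_prop) h1.measurable]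
    rfl
  have : IsProbabilityMeasure ((Measure.pi fun k =>
      gaussianReal 0 (NNReal.mk (u k ^ 2) (sq_nonneg _) * v)).map (fun p : Fin n → ℝ => ∑ k, p k)) :=
    Measure.isProbabilityMeasure_map (by fun_prop)
  rw [h2]
  refine Measure.ext_of_charFun ?_
  rw [charFun_map_sum_pi_eq_prod]
  ext t
  rw [Finset.prod_apply]
  simp only [charFun_gaussianReal]
  rw [← Complex.exp_sum]
  congr 1
  simp only [NNReal.coe_mul, NNReal.coe_mk, Real.coe_toNNReal _ huu]
  rw [dotProduct]
  push_cast
  simp only [mul_zero, zero_mul, zero_sub]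
  rw [Finset.sum_neg_distrib, Finset.mul_sum, Finset.sum_mul, Finset.sum_div]
  congr 1
  refine Finset.sum_congr rfl fun k _ => ?_
  ring

lemma gaussianVec_dotProduct_mem_Icc_le {v : NNReal} (hv : v ≠ 0) {u : Fin n → ℝ}
    (hu : 0 < u ⬝ᵥ u) (a b : ℝ) :
    gaussianVec n v {x | u ⬝ᵥ x ∈ Set.Icc a b} ≤
      ENNReal.ofReal ((b - a) / (2 * (√v * √(u ⬝ᵥ u)))) := by
  have hm : Measurable fun x : Fin n → ℝ => u ⬝ᵥ x := by unfold dotProduct; fun_prop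
  have h1 : gaussianVec n v {x | u ⬝ᵥ x ∈ Set.Icc a b} =
      (gaussianVec n v).map (fun x => u ⬝ᵥ x) (Set.Icc a b) := by
    rw [Measure.map_apply hm measurableSet_Icc]; rfl
  rw [h1, gaussianVec_map_dotProduct]
  refine (gaussianReal_Icc_le (mul_ne_zero hv (by simpa using hu)) a b).trans_eq ?_
  rw [NNReal.coe_mul, Real.coe_toNNReal _ hu.le, Real.sqrt_mul v.coe_nonneg]

lemma gaussianVec_abs_dotProduct_le {v : NNReal} (hv : v ≠ 0) {u : Fin n → ℝ}
    (hu : 0 < u ⬝ᵥ u) (z : Fin n → ℝ) (b : ℝ) :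
    gaussianVec n v {x | |(z + x) ⬝ᵥ u| ≤ b} ≤ ENNReal.ofReal (b / (√v * √(u ⬝ᵥ u))) := by
  refine (measure_mono ?_).trans ((gaussianVec_dotProduct_mem_Icc_le hv hu
    (-b - z ⬝ᵥ u) (b - z ⬝ᵥ u)).trans_eq ?_)
  · intro x hx
    rw [Set.mem_ofPred_eq, add_dotProduct, abs_le] at hx
    rw [Set.mem_ofPred_eq, dotProduct_comm u x]
    constructor <;> linarith
  · congr 1
    rw [show b - z ⬝ᵥ u - (-b - z ⬝ᵥ u) = 2 * b by ring, mul_div_mul_left _ _ two_ne_zero]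

lemma gaussianVec_abs_dotProduct_mem_Icc_le {v : NNReal} (hv : v ≠ 0) {u : Fin n → ℝ}
    (hu : 0 < u ⬝ᵥ u) (z : Fin n → ℝ) {a b : ℝ} (hab : a ≤ b) :
    gaussianVec n v {x | |(z + x) ⬝ᵥ u| ∈ Set.Icc a b} ≤
      ENNReal.ofReal ((b - a) / (√v * √(u ⬝ᵥ u))) := by
  have h1 := gaussianVec_dotProduct_mem_Icc_le hv hu (a - z ⬝ᵥ u) (b - z ⬝ᵥ u)
  have h2 := gaussianVec_dotProduct_mem_Icc_le hv hu (-b - z ⬝ᵥ u) (-a - z ⬝ᵥ u)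
  have hsub : {x | |(z + x) ⬝ᵥ u| ∈ Set.Icc a b} ⊆
      {x | u ⬝ᵥ x ∈ Set.Icc (a - z ⬝ᵥ u) (b - z ⬝ᵥ u)} ∪
        {x | u ⬝ᵥ x ∈ Set.Icc (-b - z ⬝ᵥ u) (-a - z ⬝ᵥ u)} := by
    intro x hx
    rw [Set.mem_ofPred_eq, add_dotProduct, dotProduct_comm x u] at hx
    rcases abs_cases (z ⬝ᵥ u + u ⬝ᵥ x) with ⟨h, -⟩ | ⟨h, -⟩
    · left; rw [h] at hx; exact ⟨by linarith [hx.1], by linarith [hx.2]⟩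
    · right; rw [h] at hx; exact ⟨by linarith [hx.2], by linarith [hx.1]⟩
  refine (measure_mono hsub).trans ((measure_union_le _ _).trans ((add_le_add h1 h2).trans_eq ?_))
  rw [← ENNReal.ofReal_add (by apply div_nonneg; linarith; positivity)
    (by apply div_nonneg; linarith; positivity)]
  congr 1
  rw [← add_div, ← mul_div_mul_left (b - a) _ (two_ne_zero (α := ℝ))]
  congr 1
  ring

/-- The distance of a Gaussian vector to a subspace of dimension less than `d ≤ n` is rarely much
smaller than `√(v * n / d)`. -/
lemma gaussianVec_dist_lt_le {v : NNReal} (hv : v ≠ 0) (hdn : d ≤ n)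
    (V : Submodule ℝ (EuclideanSpace ℝ (Fin n))) (hV : Module.finrank ℝ V < d)
    (z : Fin n → ℝ) {t : ℝ} (ht : 0 ≤ t) :
    gaussianVec n v {x | ∃ s ∈ V, ‖WithLp.toLp 2 (z + x) - s‖ < t} ≤
      ENNReal.ofReal (3 * t * √d / √(n * v)) := by
  set m := Module.finrank ℝ Vᗮ with hm
  have hmn : Module.finrank ℝ V + m = n := by
    rw [hm, Submodule.finrank_add_finrank_orthogonal, finrank_euclideanSpace_fin]
  have hm0 : 0 < m := by omega
  have hmR : (0 : ℝ) < m := by exact_mod_cast hm0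
  have hnR : (0 : ℝ) < n := by exact_mod_cast (by omega : 0 < n)
  have hvR : (0 : ℝ) < v := by positivity
  -- The codimension `m` is at least `n - d + 1`, and `(n - d + 1) d ≥ n` for `1 ≤ d ≤ n`.
  have hmd : (n : ℝ) ≤ m * d := by
    have : n ≤ m * d := by
      obtain ⟨e, rfl⟩ : ∃ e, d = Module.finrank ℝ V + 1 + e := ⟨d - (Module.finrank ℝ V + 1), by omega⟩
      nlinarith [Nat.zero_le (Module.finrank ℝ V)]
    exact_mod_cast this
  set b : Fin m → EuclideanSpace ℝ (Fin n) := fun k => (stdOrthonormalBasis ℝ Vᗮ k : _) with hb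
  have hbo : Orthonormal ℝ b :=
    (stdOrthonormalBasis ℝ Vᗮ).orthonormal.comp_linearIsometry Vᗮ.subtypeₗᵢ
  have hbV : ∀ k, ∀ s ∈ V, inner ℝ (b k) s = 0 := fun k s hs =>
    (Submodule.mem_orthogonal' _ _).1 (stdOrthonormalBasis ℝ Vᗮ k).2 s hs
  -- With this threshold, Bessel forces at least half of the `m` coordinates orthogonal to `V` below
  -- `θ` whenever the distance is below `t`. Markov applied to the number of small coordinates gives
  -- `2θ/√v`; no independence between coordinates is needed.
  set θ := t * √(2 / m) with hθ
  set B : Fin m → Set (Fin n → ℝ) := fun k => {x | |(z + x) ⬝ᵥ (b k).ofLp| ≤ θ} with hB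
  have hBmeas : ∀ k, MeasurableSet (B k) := by
    intro k
    have : Measurable fun x : Fin n → ℝ => |(z + x) ⬝ᵥ (b k).ofLp| := by
      unfold dotProduct
      generalize (b k).ofLp = q
      simp only [Pi.add_apply]
      fun_prop
    exact this measurableSet_Iic
  have hunit : ∀ k, (b k).ofLp ⬝ᵥ (b k).ofLp = 1 := by
    intro k
    have h := hbo.1 k
    have h2 := EuclideanSpace.real_norm_sq_eq (b k)
    rw [h] at h2
    simp only [dotProduct, ← sq]
    simpa using h2.symm
  have hBle : ∀ k, gaussianVec n v (B k) ≤ ENNReal.ofReal (θ / √v) := by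
    intro k
    refine (gaussianVec_abs_dotProduct_le hv (by rw [hunit]; exact one_pos) z θ).trans_eq ?_
    rw [hunit, Real.sqrt_one, mul_one]
  set f : (Fin n → ℝ) → ℝ≥0∞ := fun x => ∑ k, (B k).indicator 1 x with hf
  have hfmeas : Measurable f :=
    Finset.measurable_sum _ fun k _ => measurable_one.indicator (hBmeas k)
  have hsub : {x | ∃ s ∈ V, ‖WithLp.toLp 2 (z + x) - s‖ < t} ⊆
      {x | ENNReal.ofReal (m / 2) ≤ f x} := by
    classical
    rintro x ⟨s, hs, hst⟩
    have hbessel := hbo.sum_inner_products_le (s := Finset.univ) (WithLp.toLp 2 (z + x) - s)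
    have hin : ∀ k, inner ℝ (b k) (WithLp.toLp 2 (z + x) - s) = (z + x) ⬝ᵥ (b k).ofLp := by
      intro k
      rw [inner_sub_right, hbV k s hs, sub_zero, EuclideanSpace.inner_eq_star_dotProduct]
      simp
    simp only [hin, Real.norm_eq_abs, sq_abs] at hbessel
    set S := Finset.univ.filter fun k => x ∈ B k with hS
    have hfx : f x = (S.card : ℝ≥0∞) := by
      simp [hf, Set.indicator_apply, hS]
    have h1 : ((Finset.univ \ S).card : ℝ) * θ ^ 2 ≤ t ^ 2 := by
      calc ((Finset.univ \ S).card : ℝ) * θ ^ 2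
          = ∑ k ∈ Finset.univ \ S, θ ^ 2 := by simp
        _ ≤ ∑ k ∈ Finset.univ \ S, ((z + x) ⬝ᵥ (b k).ofLp) ^ 2 := by
            refine Finset.sum_le_sum fun k hk => ?_
            have : ¬ |(z + x) ⬝ᵥ (b k).ofLp| ≤ θ := by
              simpa [hS, hB] using hk
            rw [← sq_abs ((z + x) ⬝ᵥ (b k).ofLp)]
            push Not at this
            exact pow_le_pow_left₀ (by positivity) this.le 2
        _ ≤ ∑ k, ((z + x) ⬝ᵥ (b k).ofLp) ^ 2 :=
            Finset.sum_le_sum_of_subset_of_nonneg (Finset.subset_univ _)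
              fun _ _ _ => sq_nonneg _
        _ ≤ _ := hbessel
        _ ≤ t ^ 2 := pow_le_pow_left₀ (norm_nonneg _) hst.le 2
    have ht0 : 0 < t := (norm_nonneg _).trans_lt hst
    have hθ2 : θ ^ 2 = t ^ 2 * (2 / m) := by
      rw [hθ, mul_pow, Real.sq_sqrt (by positivity)]
    have h2 : ((Finset.univ \ S).card : ℝ) ≤ m / 2 := by
      rw [hθ2] at h1
      have h3 : t ^ 2 * (((Finset.univ \ S).card : ℝ) * (2 / m)) ≤ t ^ 2 * 1 := by linarith
      have h4 := le_of_mul_le_mul_left h3 (by positivity)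
      rw [mul_div_assoc', div_le_one hmR] at h4
      linarith
    have h3 : ((Finset.univ \ S).card : ℝ) = m - S.card := by
      have := Finset.card_sdiff_add_card_eq_card (Finset.subset_univ S)
      rw [Finset.card_univ, Fintype.card_fin] at this
      rw [eq_sub_iff_add_eq]
      exact_mod_cast this
    rw [Set.mem_ofPred_eq, hfx, ← ENNReal.ofReal_natCast]
    refine ENNReal.ofReal_le_ofReal ?_
    linarith
  have hint : ∫⁻ x, f x ∂(gaussianVec n v) ≤ ENNReal.ofReal (m * (θ / √v)) := by
    rw [lintegral_finsetSum _ fun k _ => measurable_one.indicator (hBmeas k)]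
    calc ∑ k, ∫⁻ x, (B k).indicator 1 x ∂(gaussianVec n v)
        ≤ ∑ _k : Fin m, ENNReal.ofReal (θ / √v) := by
          refine Finset.sum_le_sum fun k _ => ?_
          rw [lintegral_indicator_one (hBmeas k)]
          exact hBle k
      _ = _ := by
          rw [Finset.sum_const, Finset.card_univ, Fintype.card_fin, nsmul_eq_mul,
            ENNReal.ofReal_mul (by positivity), ENNReal.ofReal_natCast]
  have hmarkov := mul_meas_ge_le_lintegral (μ := gaussianVec n v) hfmeas (ENNReal.ofReal (m / 2))
  refine (measure_mono hsub).trans ?_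
  have h1 : gaussianVec n v {x | ENNReal.ofReal (m / 2) ≤ f x} ≤
      ENNReal.ofReal (m * (θ / √v)) / ENNReal.ofReal (m / 2) := by
    rw [ENNReal.le_div_iff_mul_le (Or.inl (by simpa using hm0)) (Or.inl ENNReal.ofReal_ne_top),
      mul_comm]
    exact hmarkov.trans hint
  refine h1.trans ?_
  rw [← ENNReal.ofReal_div_of_pos (by positivity)]
  refine ENNReal.ofReal_le_ofReal ?_
  have e1 : m * (θ / √(v : ℝ)) / (m / 2) = 2 * θ / √(v : ℝ) := by field_simp
  rw [e1, hθ, Real.sqrt_mul hnR.le, ← div_div]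
  refine div_le_div_of_nonneg_right ?_ (Real.sqrt_nonneg _)
  rw [le_div_iff₀ (Real.sqrt_pos.2 hnR)]
  have e2 : 2 * √(2 / m) * √n ≤ 3 * √d := by
    rw [show (2 : ℝ) * √(2 / m) * √n = √(8 * n / m) by
        rw [show (2 : ℝ) = √4 by rw [show (4 : ℝ) = 2 ^ 2 by norm_num, Real.sqrt_sq]; norm_num,
          ← Real.sqrt_mul (by norm_num), ← Real.sqrt_mul (by positivity)]
        congr 1
        rw [show √4 = (2 : ℝ) by rw [show (4 : ℝ) = 2 ^ 2 by norm_num, Real.sqrt_sq]; norm_num]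
        ring,
      show (3 : ℝ) = √9 by rw [show (9 : ℝ) = 3 ^ 2 by norm_num, Real.sqrt_sq]; norm_num,
      ← Real.sqrt_mul (by norm_num)]
    refine Real.sqrt_le_sqrt ?_
    rw [div_le_iff₀ hmR]
    nlinarith
  calc 2 * (t * √(2 / m)) * √n = t * (2 * √(2 / m) * √n) := by ring
    _ ≤ t * (3 * √d) := by gcongr
    _ = 3 * t * √d := by ring

/-! ### The noise matrix, conditioned on all columns but one. -/

/-- Replacing one column of a Gaussian matrix by an independent copy does not change the law. -/
lemma measurePreserving_updateCol (n : ℕ) (j : Fin d) (σ : ℝ) :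
    MeasurePreserving
      (fun p : (Fin n → Fin d → ℝ) × (Fin n → ℝ) => fun k => Function.update (p.1 k) j (p.2 k))
      ((noise n d σ).prod (gaussianVec n (σ ^ 2 / n).toNNReal)) (noise n d σ) := by
  set v := (σ ^ 2 / n).toNNReal
  have hrow : MeasurePreserving (fun q : (Fin d → ℝ) × ℝ => Function.update q.1 j q.2)
      ((Measure.pi fun _ => gaussianReal 0 v).prod (gaussianReal 0 v))
      (Measure.pi fun _ => gaussianReal 0 v) := by
    have hmeas : Measurable fun q : (Fin d → ℝ) × ℝ => Function.update q.1 j q.2 := by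
      refine measurable_pi_iff.2 fun l => ?_
      by_cases h : l = j
      · subst h; simpa using measurable_snd
      · simpa [h] using (by fun_prop : Measurable fun q : (Fin d → ℝ) × ℝ => q.1 l)
    refine ⟨hmeas, (Measure.pi_eq fun s hs => ?_).symm⟩
    rw [Measure.map_apply hmeas (MeasurableSet.univ_pi hs)]
    have e : (fun q : (Fin d → ℝ) × ℝ => Function.update q.1 j q.2) ⁻¹' Set.univ.pi s =
        (Set.univ.pi (Function.update s j Set.univ)) ×ˢ s j := by
      ext q
      simp only [Set.mem_preimage, Set.mem_pi, Set.mem_univ, true_implies, Set.mem_prod]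
      constructor
      · intro h
        refine ⟨fun l => ?_, by simpa using h j⟩
        by_cases hl : l = j
        · subst hl; simp
        · simpa [hl] using h l
      · rintro ⟨h1, h2⟩ l
        by_cases hl : l = j
        · subst hl; simpa using h2
        · simpa [hl] using h1 l
    rw [e, Measure.prod_prod, Measure.pi_pi, ← Finset.prod_erase_mul _ _ (Finset.mem_univ j),
      ← Finset.prod_erase_mul _ (fun l => gaussianReal 0 v (s l)) (Finset.mem_univ j)]
    simp only [Function.update_self, measure_univ, mul_one]
    congr 1
    refine Finset.prod_congr rfl fun l hl => ?_
    rw [Function.update_of_ne (Finset.ne_of_mem_erase hl)]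
  have h1 := (measurePreserving_arrowProdEquivProdArrow (Fin d → ℝ) ℝ (Fin n)
    (fun _ => Measure.pi fun _ => gaussianReal 0 v) (fun _ => gaussianReal 0 v)).symm
  exact (measurePreserving_pi (fun _ : Fin n => _) (fun _ => _) fun _ => hrow).comp h1

/-- Fubini after resampling column `j`: a bound valid for every choice of the other columns holds
for the whole matrix. -/
lemma noise_le_of_forall_updateCol {σ : ℝ} (j : Fin d) {A : Set (Fin n → Fin d → ℝ)}
    (hA : MeasurableSet A) {c : ℝ≥0∞}
    (h : ∀ G : Fin n → Fin d → ℝ, gaussianVec n (σ ^ 2 / n).toNNReal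
      {x | (fun k => Function.update (G k) j (x k)) ∈ A} ≤ c) :
    noise n d σ A ≤ c := by
  have hmp := measurePreserving_updateCol n j σ
  rw [← hmp.measure_preimage hA.nullMeasurableSet, Measure.prod_apply (hmp.measurable hA)]
  calc ∫⁻ G, gaussianVec n (σ ^ 2 / n).toNNReal _ ∂(noise n d σ)
      ≤ ∫⁻ _, c ∂(noise n d σ) := lintegral_mono fun G => h G
    _ = c := by simp

lemma lintegral_sum_sq_noise {σ : ℝ} (hn : 0 < n) :
    ∫⁻ G, ENNReal.ofReal (∑ k, ∑ j, G k j ^ 2) ∂(noise n d σ) = ENNReal.ofReal (d * σ ^ 2) := by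
  set v := (σ ^ 2 / n).toNNReal with hv
  have hnR : (0 : ℝ) < n := by exact_mod_cast hn
  have h1 : ∫⁻ x, ENNReal.ofReal (x ^ 2) ∂(gaussianReal 0 v) = ENNReal.ofReal (σ ^ 2 / n) := by
    have hint : Integrable (fun x : ℝ => x ^ 2) (gaussianReal 0 v) :=
      (memLp_id_gaussianReal 2).integrable_sq
    rw [← ofReal_integral_eq_lintegral_ofReal hint (ae_of_all _ fun x => sq_nonneg x)]
    congr 1
    have := variance_fun_id_gaussianReal (μ := 0) (v := v)
    rw [variance_eq_integral (by fun_prop)] at this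
    simp only [integral_id_gaussianReal, sub_zero] at this
    rw [this, hv, Real.coe_toNNReal _ (by positivity)]
  have h2 : ∀ k j, ∫⁻ G, ENNReal.ofReal (G k j ^ 2) ∂(noise n d σ) =
      ENNReal.ofReal (σ ^ 2 / n) := by
    intro k j
    have e1 : MeasurePreserving (fun G : Fin n → Fin d → ℝ => G k) (noise n d σ)
        (Measure.pi fun _ => gaussianReal 0 v) := measurePreserving_eval _ k
    have e2 : MeasurePreserving (fun g : Fin d → ℝ => g j) (Measure.pi fun _ => gaussianReal 0 v)
        (gaussianReal 0 v) := measurePreserving_eval _ j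
    rw [← h1, ← (e2.comp e1).lintegral_comp (by fun_prop)]
    rfl
  have h3 : ∀ G : Fin n → Fin d → ℝ, ENNReal.ofReal (∑ k, ∑ j, G k j ^ 2) =
      ∑ k, ∑ j, ENNReal.ofReal (G k j ^ 2) := by
    intro G
    rw [ENNReal.ofReal_sum_of_nonneg fun _ _ => Finset.sum_nonneg fun _ _ => sq_nonneg _]
    refine Finset.sum_congr rfl fun k _ => ?_
    rw [ENNReal.ofReal_sum_of_nonneg fun _ _ => sq_nonneg _]
  simp only [h3]
  rw [lintegral_finsetSum _ fun k _ => by fun_prop]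
  have h4 : ∀ k, ∫⁻ G, ∑ j, ENNReal.ofReal (G k j ^ 2) ∂(noise n d σ) =
      d * ENNReal.ofReal (σ ^ 2 / n) := by
    intro k
    rw [lintegral_finsetSum _ fun j _ => by fun_prop]
    simp [h2]
  simp only [h4, Finset.sum_const, Finset.card_univ, Fintype.card_fin, nsmul_eq_mul]
  rw [← ENNReal.ofReal_natCast, ← ENNReal.ofReal_natCast, ← ENNReal.ofReal_mul (by positivity),
    ← ENNReal.ofReal_mul (by positivity)]
  congr 1
  field_simp

lemma noise_sum_sq_gt_le {σ : ℝ} (hn : 0 < n) {T : ℝ} (hT : 0 < T) :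
    noise n d σ {G | T < ∑ k, ∑ j, G k j ^ 2} ≤ ENNReal.ofReal (d * σ ^ 2 / T) := by
  have h := mul_meas_ge_le_lintegral (μ := noise n d σ)
    (f := fun G => ENNReal.ofReal (∑ k, ∑ j, G k j ^ 2)) (by fun_prop) (ENNReal.ofReal T)
  rw [lintegral_sum_sq_noise hn] at h
  rw [ENNReal.ofReal_div_of_pos hT, ENNReal.le_div_iff_mul_le (Or.inl (by simpa using hT))
    (Or.inl ENNReal.ofReal_ne_top), mul_comm]
  refine le_trans ?_ h
  gcongr
  intro hG
  exact ENNReal.ofReal_le_ofReal hG.le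

lemma sqrt_noise_var {σ : ℝ} (hσ : 0 < σ) :
    √((σ ^ 2 / n).toNNReal : ℝ) = σ / √n := by
  rw [Real.coe_toNNReal _ (by positivity), Real.sqrt_div (sq_nonneg _), Real.sqrt_sq hσ.le]

lemma noise_var_ne_zero {σ : ℝ} (hσ : 0 < σ) (hn : 0 < n) : (σ ^ 2 / n).toNNReal ≠ 0 := by
  have : (0 : ℝ) < n := by exact_mod_cast hn
  have h : 0 < σ ^ 2 / n := by positivity
  simpa using h

lemma continuous_mulVec_apply {T : Type*} [TopologicalSpace T]
    {f : T → Matrix (Fin n) (Fin d) ℝ} {g : T → Fin d → ℝ}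
    (hf : ∀ k j, Continuous fun t => f t k j) (hg : ∀ j, Continuous fun t => g t j) (k : Fin n) :
    Continuous fun t => (f t *ᵥ g t) k := by
  simp only [Matrix.mulVec, dotProduct]
  fun_prop

/-- A column of a Gaussian perturbation is rarely close to the span of other columns. Here `Φ G` is
a matrix whose `j`-th column is Gaussian and whose other columns are independent of it. -/
lemma noise_exists_mulVec_small_le {σ : ℝ} (hσ : 0 < σ) (hd : 1 ≤ d) (hdn : d ≤ n) (j : Fin d)
    (z : Fin n → ℝ) {Φ : (Fin n → Fin d → ℝ) → Matrix (Fin n) (Fin d) ℝ}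
    (hΦc : ∀ k l, Continuous fun G => Φ G k l) (hΦj : ∀ G k, Φ G k j = z k + G k j)
    (hΦ : ∀ (G : Fin n → Fin d → ℝ) (x : Fin n → ℝ) k l, l ≠ j →
      Φ (fun k => Function.update (G k) j (x k)) k l = Φ G k l) {t : ℝ} (ht : 0 ≤ t) :
    noise n d σ {G | ∃ c : Fin d → ℝ, c j = 1 ∧ (Φ G *ᵥ c) ⬝ᵥ (Φ G *ᵥ c) < t ^ 2} ≤
      ENNReal.ofReal (3 * t * √d / σ) := by
  have hn : 0 < n := by omega
  have hnR : (0 : ℝ) < n := by exact_mod_cast hn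
  -- The existential over `c` is uncountable, so measurability comes from openness.
  have hopen : IsOpen {G | ∃ c : Fin d → ℝ, c j = 1 ∧ (Φ G *ᵥ c) ⬝ᵥ (Φ G *ᵥ c) < t ^ 2} := by
    have e : {G | ∃ c : Fin d → ℝ, c j = 1 ∧ (Φ G *ᵥ c) ⬝ᵥ (Φ G *ᵥ c) < t ^ 2} =
        ⋃ (c : Fin d → ℝ) (_ : c j = 1), {G | (Φ G *ᵥ c) ⬝ᵥ (Φ G *ᵥ c) < t ^ 2} := by
      ext G; simp
    rw [e]
    refine isOpen_iUnion fun c => isOpen_iUnion fun _ => ?_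
    refine isOpen_lt ?_ continuous_const
    have := continuous_mulVec_apply hΦc (g := fun _ => c) fun _ => continuous_const
    exact continuous_finsetSum _ fun k _ => (this k).mul (this k)
  refine noise_le_of_forall_updateCol j hopen.measurableSet fun G => ?_
  set b : {l : Fin d // l ≠ j} → EuclideanSpace ℝ (Fin n) :=
    fun l => WithLp.toLp 2 fun k => Φ G k l with hb
  have hrank : Module.finrank ℝ (Submodule.span ℝ (Set.range b)) < d := by
    refine lt_of_le_of_lt (finrank_range_le_card b) ?_
    rw [Fintype.card_subtype_compl, Fintype.card_fin, Fintype.card_subtype_eq]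
    omega
  refine (measure_mono ?_).trans ((gaussianVec_dist_lt_le (noise_var_ne_zero hσ hn) hdn
    (Submodule.span ℝ (Set.range b)) hrank z ht).trans_eq ?_)
  · rintro x ⟨c, hcj, hc⟩
    refine ⟨-∑ l, c l.1 • b l, neg_mem (sum_mem fun l _ =>
      Submodule.smul_mem _ _ (Submodule.subset_span ⟨l, rfl⟩)), ?_⟩
    refine lt_of_pow_lt_pow_left₀ 2 ht ?_
    refine lt_of_eq_of_lt ?_ hc
    rw [EuclideanSpace.real_norm_sq_eq, dotProduct]
    refine Finset.sum_congr rfl fun k _ => ?_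
    rw [← sq]
    congr 1
    rw [Matrix.mulVec, dotProduct, ← Finset.add_sum_erase _ _ (Finset.mem_univ j), hΦj, hcj]
    simp only [sub_neg_eq_add, PiLp.add_apply, Pi.add_apply, Function.update_self, mul_one]
    congr 1
    rw [WithLp.ofLp_sum, Finset.sum_apply]
    simp only [hb, PiLp.smul_apply, smul_eq_mul]
    rw [← Finset.sum_subtype (s := Finset.univ.erase j) (p := fun l => l ≠ j) (by simp)
      (f := fun l => c l * Φ G k l)]
    refine Finset.sum_congr rfl fun l hl => ?_
    rw [hΦ G x k l (Finset.ne_of_mem_erase hl), mul_comm]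
  · congr 2
    rw [Real.coe_toNNReal _ (by positivity), mul_div_cancel₀ _ hnR.ne', Real.sqrt_sq hσ.le]

/-! ### Probability that an entry of the minimizer is small. -/

section Events

variable (Xhat : Matrix (Fin n) (Fin d) ℝ) (y : EuclideanSpace ℝ (Fin n))

/-- The event that some minimizer has `i`-th entry of size in `[a, b]`, while the `i`-th column has
norm at most `R` and `y` is at distance at least `τ` from the span of the other columns. -/
def entryEvent (i : Fin d) (lam a b R τ : ℝ) : Set (Fin n → Fin d → ℝ) :=
  {G | ∃ w : Fin d → ℝ, IsKKT (Xhat + Matrix.of G) y.ofLp lam w ∧ (a ≤ |w i| ∧ |w i| ≤ b) ∧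
    (Xhat + Matrix.of G).col i ⬝ᵥ (Xhat + Matrix.of G).col i ≤ R ^ 2 ∧
    ∀ v : Fin d → ℝ, v i = 0 → τ ^ 2 ≤
      (y.ofLp - (Xhat + Matrix.of G) *ᵥ v) ⬝ᵥ (y.ofLp - (Xhat + Matrix.of G) *ᵥ v)}

lemma isClosed_exists_mem_of_isCompact {S T : Type*} [TopologicalSpace S] [TopologicalSpace T]
    {K : Set T} (hK : IsCompact K) {C : Set (S × T)} (hC : IsClosed C) :
    IsClosed {s | ∃ t ∈ K, (s, t) ∈ C} := by
  have : CompactSpace K := isCompact_iff_compactSpace.1 hK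
  have h1 : IsClosed {p : S × K | (p.1, (p.2 : T)) ∈ C} :=
    hC.preimage (by fun_prop)
  have h2 := isClosedMap_fst_of_compactSpace (X := S) (Y := K) _ h1
  convert h2 using 1
  ext s
  simp

/-- The existential over `w` is a projection; the a priori bound on minimizers makes the fibre
compact, so the projection is closed. -/
lemma isClosed_entryEvent (i : Fin d) {lam : ℝ} (hl : 0 < lam) (a b R τ : ℝ) :
    IsClosed (entryEvent Xhat y i lam a b R τ) := by
  set B := ‖y‖ ^ 2 / (2 * lam) with hB
  have hB0 : 0 ≤ B := by positivity
  set X : (Fin n → Fin d → ℝ) → Matrix (Fin n) (Fin d) ℝ := fun G => Xhat + Matrix.of G with hX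
  have hXc : ∀ k j, Continuous fun p : (Fin n → Fin d → ℝ) × (Fin d → ℝ) => X p.1 k j := by
    intro k j
    simp only [hX, Matrix.add_apply, Matrix.of_apply]
    fun_prop
  have hXv : ∀ v : Fin d → ℝ, ∀ k, Continuous fun p : (Fin n → Fin d → ℝ) × (Fin d → ℝ) =>
      (y.ofLp - X p.1 *ᵥ v) k := fun v k =>
    continuous_const.sub (continuous_mulVec_apply (g := fun _ => v) hXc (fun _ => continuous_const) k)
  have hres : ∀ k, Continuous fun p : (Fin n → Fin d → ℝ) × (Fin d → ℝ) =>
      (y.ofLp - X p.1 *ᵥ p.2) k := fun k =>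
    continuous_const.sub (continuous_mulVec_apply hXc (fun j => by fun_prop) k)
  have hcorr : ∀ l, Continuous fun p : (Fin n → Fin d → ℝ) × (Fin d → ℝ) =>
      ((X p.1)ᵀ *ᵥ (y.ofLp - X p.1 *ᵥ p.2)) l :=
    continuous_mulVec_apply (fun k j => hXc j k) hres
  have hC : IsClosed {p : (Fin n → Fin d → ℝ) × (Fin d → ℝ) |
      IsKKT (X p.1) y.ofLp lam p.2 ∧ (a ≤ |p.2 i| ∧ |p.2 i| ≤ b) ∧
      (X p.1).col i ⬝ᵥ (X p.1).col i ≤ R ^ 2 ∧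
      ∀ v : Fin d → ℝ, v i = 0 → τ ^ 2 ≤ (y.ofLp - X p.1 *ᵥ v) ⬝ᵥ (y.ofLp - X p.1 *ᵥ v)} := by
    refine IsClosed.and ?_ (IsClosed.and (IsClosed.and ?_ ?_) (IsClosed.and ?_ ?_))
    · unfold IsKKT
      rw [Set.ofPred_forall]
      refine isClosed_iInter fun l => IsClosed.and ?_ ?_
      · exact isClosed_le (hcorr l).abs continuous_const
      · exact isClosed_eq ((hcorr l).mul (by fun_prop)) (by fun_prop)
    · exact isClosed_le continuous_const (by fun_prop)
    · exact isClosed_le (by fun_prop) continuous_const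
    · exact isClosed_le (continuous_finsetSum _ fun k _ => (hXc k i).mul (hXc k i))
        continuous_const
    · rw [Set.ofPred_forall]
      refine isClosed_iInter fun v => ?_
      by_cases hv : v i = 0
      · simp only [hv, true_implies]
        exact isClosed_le continuous_const
          (continuous_finsetSum _ fun k _ => (hXv v k).mul (hXv v k))
      · simp [hv]
  convert isClosed_exists_mem_of_isCompact (isCompact_closedBall (0 : Fin d → ℝ) B) hC using 1
  ext G
  constructor
  · rintro ⟨w, hw, h⟩
    refine ⟨w, ?_, hw, h⟩
    rw [mem_closedBall_zero_iff, pi_norm_le_iff_of_nonneg hB0]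
    intro j
    have h1 := hw.sum_abs_le
    have h2 : |w j| ≤ ∑ j, |w j| :=
      Finset.single_le_sum (f := fun j => |w j|) (fun _ _ => abs_nonneg _) (Finset.mem_univ j)
    rw [Real.norm_eq_abs, hB, le_div_iff₀ (by positivity)]
    have h3 := mul_le_mul_of_nonneg_left h2 hl.le
    linarith
  · rintro ⟨w, -, hw, h⟩
    exact ⟨w, hw, h⟩

/-- The matrix `X` with the `i`-th column replaced by zero. -/
def zeroCol (X : Matrix (Fin n) (Fin d) ℝ) (i : Fin d) : Matrix (Fin n) (Fin d) ℝ :=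
  Matrix.of fun k j => if j = i then 0 else X k j

lemma zeroCol_add_of_update (G : Fin n → Fin d → ℝ) (i : Fin d) (x : Fin n → ℝ) (k : Fin n)
    (j : Fin d) : zeroCol (Xhat + Matrix.of G) i k j = if j = i then 0 else
      (Xhat + Matrix.of fun k => Function.update (G k) i (x k)) k j := by
  by_cases h : j = i <;> simp [zeroCol, h]

lemma col_add_of_update (G : Fin n → Fin d → ℝ) (i : Fin d) (x : Fin n → ℝ) :
    (Xhat + Matrix.of fun k => Function.update (G k) i (x k)).col i = Xhat.col i + x := by
  funext k
  simp [Matrix.col]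

/-- The event that some minimizer has a nonzero `i`-th entry of size at most `b`, while the `i`-th
column has norm at most `R`. -/
def smallEntryEvent (i : Fin d) (lam b R : ℝ) : Set (Fin n → Fin d → ℝ) :=
  {G | ∃ w : Fin d → ℝ, IsKKT (Xhat + Matrix.of G) y.ofLp lam w ∧ w i ≠ 0 ∧ |w i| ≤ b ∧
    (Xhat + Matrix.of G).col i ⬝ᵥ (Xhat + Matrix.of G).col i ≤ R ^ 2}

lemma measurableSet_smallEntryEvent (i : Fin d) {lam : ℝ} (hl : 0 < lam) (b R : ℝ) :
    MeasurableSet (smallEntryEvent Xhat y i lam b R) := by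
  -- The condition `w i ≠ 0` is a countable union of closed conditions; taking `τ = 0` makes the
  -- distance requirement void.
  have hAe : smallEntryEvent Xhat y i lam b R =
      ⋃ m : ℕ, entryEvent Xhat y i lam (1 / (m + 1)) b R 0 := by
    ext G
    rw [Set.mem_iUnion]
    constructor
    · rintro ⟨w, h1, h2, h3, h4⟩
      obtain ⟨m, hm⟩ := exists_nat_one_div_lt (abs_pos.2 h2)
      refine ⟨m, w, h1, ⟨hm.le, h3⟩, h4, fun v _ => ?_⟩
      rw [zero_pow two_ne_zero]
      exact dotProduct_self_nonneg_real _
    · rintro ⟨m, w, h1, ⟨h2, h3⟩, h4, -⟩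
      have : (0 : ℝ) < 1 / (m + 1) := by positivity
      exact ⟨w, h1, abs_pos.1 (this.trans_le h2), h3, h4⟩
  rw [hAe]
  exact MeasurableSet.iUnion fun m => (isClosed_entryEvent Xhat y i hl _ _ _ _).measurableSet

/-- The leave-one-out residual `r` is fixed once the other columns are, and the event puts `|x·r|`
in an interval of length `b * R ^ 2`. It also forces `‖r‖ ≥ lam / R` by Cauchy-Schwarz; if `r` is
shorter, the conditional event is empty. -/
lemma noise_smallEntryEvent_le {σ : ℝ} (hσ : 0 < σ) (hn : 0 < n) (i : Fin d) {lam b R : ℝ}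
    (hl : 0 < lam) (hb : 0 ≤ b) (hR : 0 < R) :
    noise n d σ (smallEntryEvent Xhat y i lam b R) ≤
      ENNReal.ofReal (b * R ^ 3 / (σ / √n * lam)) := by
  have hnR : (0 : ℝ) < n := by exact_mod_cast hn
  set A := smallEntryEvent Xhat y i lam b R with hA
  have hmeas : MeasurableSet A := measurableSet_smallEntryEvent Xhat y i hl b R
  refine noise_le_of_forall_updateCol i hmeas fun G => ?_
  obtain ⟨v, hv⟩ := exists_isKKT (zeroCol (Xhat + Matrix.of G) i) y hl
  set r := y.ofLp - zeroCol (Xhat + Matrix.of G) i *ᵥ v with hr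
  have hsub : ∀ x, (fun k => Function.update (G k) i (x k)) ∈ A →
      |(Xhat.col i + x) ⬝ᵥ r| ∈ Set.Icc lam (lam + b * R ^ 2) ∧ (lam / R) ^ 2 ≤ r ⬝ᵥ r := by
    rintro x ⟨w, h1, h2, h3, h4⟩
    obtain ⟨h5, h6⟩ := h1.leave_one_out hl (zeroCol_add_of_update Xhat G i x) hv
    rw [col_add_of_update] at h4 h5 h6
    rw [← hr] at h5 h6
    specialize h6 h2
    have hxx : 0 ≤ (Xhat.col i + x) ⬝ᵥ (Xhat.col i + x) := dotProduct_self_nonneg_real (Xhat.col i + x)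
    have hrr : 0 ≤ r ⬝ᵥ r := dotProduct_self_nonneg_real r
    refine ⟨⟨h6, h5.trans ?_⟩, ?_⟩
    · gcongr
    · have hcs : ((Xhat.col i + x) ⬝ᵥ r) ^ 2 ≤
          ((Xhat.col i + x) ⬝ᵥ (Xhat.col i + x)) * (r ⬝ᵥ r) := by
        simp only [dotProduct]
        simpa [sq] using Finset.sum_mul_sq_le_sq_mul_sq Finset.univ (Xhat.col i + x) r
      have h7 : lam ^ 2 ≤ ((Xhat.col i + x) ⬝ᵥ r) ^ 2 := by
        rw [← sq_abs ((Xhat.col i + x) ⬝ᵥ r)]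
        exact pow_le_pow_left₀ hl.le h6 2
      rw [div_pow, div_le_iff₀ (by positivity), mul_comm]
      exact (h7.trans hcs).trans (mul_le_mul_of_nonneg_right h4 hrr)
  by_cases hrr : (lam / R) ^ 2 ≤ r ⬝ᵥ r
  · have hrpos : 0 < r ⬝ᵥ r := lt_of_lt_of_le (by positivity) hrr
    refine (measure_mono fun x hx => (hsub x hx).1).trans
      ((gaussianVec_abs_dotProduct_mem_Icc_le (noise_var_ne_zero hσ hn) hrpos (Xhat.col i)
        (by nlinarith [sq_nonneg R])).trans (ENNReal.ofReal_le_ofReal ?_))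
    rw [sqrt_noise_var hσ, add_sub_cancel_left]
    have h1 : lam / R ≤ √(r ⬝ᵥ r) := Real.le_sqrt_of_sq_le hrr
    have hs : 0 < σ / √n := by positivity
    calc b * R ^ 2 / (σ / √n * √(r ⬝ᵥ r)) ≤ b * R ^ 2 / (σ / √n * (lam / R)) := by gcongr
      _ = _ := by field_simp
  · have : {x : Fin n → ℝ | (fun k => Function.update (G k) i (x k)) ∈ A} = ∅ := by
      ext x
      exact ⟨fun hx => (hrr (hsub x hx).2).elim, fun h => h.elim⟩
    rw [this, measure_empty]
    exact zero_le

/-- Here `w i = 0` is allowed, so only the upper bound on `|x·r|` remains and `‖r‖` cannot be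
bounded through `lam`; the distance `τ` takes that role. -/
lemma noise_entryEvent_le {σ : ℝ} (hσ : 0 < σ) (hn : 0 < n) (i : Fin d) {lam b R τ : ℝ}
    (hl : 0 < lam) (hb : 0 ≤ b) (hτ : 0 < τ) :
    noise n d σ (entryEvent Xhat y i lam 0 b R τ) ≤
      ENNReal.ofReal ((lam + b * R ^ 2) / (σ / √n * τ)) := by
  have hnR : (0 : ℝ) < n := by exact_mod_cast hn
  refine noise_le_of_forall_updateCol i
    (isClosed_entryEvent Xhat y i hl _ _ _ _).measurableSet fun G => ?_
  obtain ⟨v, hv⟩ := exists_isKKT (zeroCol (Xhat + Matrix.of G) i) y hl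
  set r := y.ofLp - zeroCol (Xhat + Matrix.of G) i *ᵥ v with hr
  have hsub : ∀ x, (fun k => Function.update (G k) i (x k)) ∈ entryEvent Xhat y i lam 0 b R τ →
      |(Xhat.col i + x) ⬝ᵥ r| ≤ lam + b * R ^ 2 ∧ τ ^ 2 ≤ r ⬝ᵥ r := by
    rintro x ⟨w, h1, ⟨-, h3⟩, h4, h5⟩
    obtain ⟨h6, -⟩ := h1.leave_one_out hl (zeroCol_add_of_update Xhat G i x) hv
    rw [col_add_of_update] at h4 h6
    rw [← hr] at h6
    have hxx : 0 ≤ (Xhat.col i + x) ⬝ᵥ (Xhat.col i + x) := dotProduct_self_nonneg_real (Xhat.col i + x)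
    refine ⟨h6.trans (by gcongr), ?_⟩
    have hvi : v i = 0 := hv.eq_zero_of_col_eq_zero hl fun k => by simp [zeroCol]
    have h7 := h5 v hvi
    rwa [← mulVec_eq_of_apply_eq_zero (Z := zeroCol (Xhat + Matrix.of G) i)
      (fun k j hj => by rw [zeroCol_add_of_update Xhat G i x, if_neg hj]) hvi] at h7
  by_cases hrr : τ ^ 2 ≤ r ⬝ᵥ r
  · have hrpos : 0 < r ⬝ᵥ r := lt_of_lt_of_le (by positivity) hrr
    refine (measure_mono fun x hx => (hsub x hx).1).trans
      ((gaussianVec_abs_dotProduct_le (noise_var_ne_zero hσ hn) hrpos (Xhat.col i) _).trans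
        (ENNReal.ofReal_le_ofReal ?_))
    rw [sqrt_noise_var hσ]
    have h1 : τ ≤ √(r ⬝ᵥ r) := Real.le_sqrt_of_sq_le hrr
    have hs : 0 < σ / √n := by positivity
    gcongr
  · have : {x : Fin n → ℝ | (fun k => Function.update (G k) i (x k)) ∈ entryEvent Xhat y i lam 0 b R τ} = ∅ := by
      ext x
      exact ⟨fun hx => (hrr (hsub x hx).2).elim, fun h => h.elim⟩
    rw [this, measure_empty]
    exact zero_le

end Events

/-! ### Residual, separation and column norm bounds. -/

/-- If `y` has norm one, the columns of `X` are bounded, and columns are separated from the span of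
the others once the `i`-th column is replaced by `y`, then `y` is separated from the span of the
columns other than the `i`-th. -/
lemma le_residual_of_colSep {X Z : Matrix (Fin n) (Fin d) ℝ} {y : Fin n → ℝ} {R κ : ℝ} {i : Fin d}
    (hy : y ⬝ᵥ y = 1) (hR : 0 < R) (hκ : 0 < κ) (hκR : κ ≤ d * R)
    (hcol : ∀ j, X.col j ⬝ᵥ X.col j ≤ R ^ 2) (hZ : ∀ k l, Z k l = if l = i then y k else X k l)
    (hsep : ∀ j, j ≠ i → ∀ c : Fin d → ℝ, c j = 1 → κ ^ 2 ≤ (Z *ᵥ c) ⬝ᵥ (Z *ᵥ c))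
    {v : Fin d → ℝ} (hv : v i = 0) :
    (κ / (2 * d * R)) ^ 2 ≤ (y - X *ᵥ v) ⬝ᵥ (y - X *ᵥ v) := by
  have hd : (0 : ℝ) < d := by exact_mod_cast i.pos
  set τ := κ / (2 * d * R) with hτ
  have hτ2 : τ ≤ 1 / 2 := by
    rw [hτ, div_le_iff₀ (by positivity)]; linarith
  have hτ0 : 0 < τ := by positivity
  by_contra! hlt
  -- The largest coefficient: since `‖y‖ = 1` and the residual is shorter than 1/2, `X v` is long,
  -- so `|v j|` exceeds `1 / (2 d R)`.
  obtain ⟨j, -, hj⟩ := Finset.exists_max_image Finset.univ (fun j => v j ^ 2) ⟨i, Finset.mem_univ i⟩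
  have hXv : (X *ᵥ v) ⬝ᵥ (X *ᵥ v) ≤ d * (d * (v j ^ 2 * R ^ 2)) := by
    calc (X *ᵥ v) ⬝ᵥ (X *ᵥ v) = ∑ k, (∑ l, X k l * v l) ^ 2 := by
          simp [dotProduct, Matrix.mulVec, sq]
      _ ≤ ∑ k, d * ∑ l, (X k l * v l) ^ 2 := by
          refine Finset.sum_le_sum fun k _ => ?_
          simpa using sq_sum_le_card_mul_sum_sq (s := Finset.univ) (f := fun l => X k l * v l)
      _ = d * ∑ l, v l ^ 2 * (X.col l ⬝ᵥ X.col l) := by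
          rw [← Finset.mul_sum, Finset.sum_comm]
          congr 1
          refine Finset.sum_congr rfl fun l _ => ?_
          rw [dotProduct, Finset.mul_sum]
          refine Finset.sum_congr rfl fun k _ => ?_
          simp only [Matrix.col_apply]
          ring
      _ ≤ d * ∑ _l : Fin d, v j ^ 2 * R ^ 2 := by
          refine mul_le_mul_of_nonneg_left (Finset.sum_le_sum fun l _ => ?_) hd.le
          exact mul_le_mul (hj l (Finset.mem_univ l)) (hcol l) (dotProduct_self_nonneg_real _)
            (sq_nonneg _)
      _ = _ := by simp
  have hyy : y ⬝ᵥ y ≤ 2 * ((y - X *ᵥ v) ⬝ᵥ (y - X *ᵥ v)) + 2 * ((X *ᵥ v) ⬝ᵥ (X *ᵥ v)) := by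
    generalize X *ᵥ v = a
    simp only [dotProduct, Finset.mul_sum, ← Finset.sum_add_distrib]
    refine Finset.sum_le_sum fun k _ => ?_
    simp only [Pi.sub_apply]
    nlinarith [sq_nonneg (y k - 2 * a k)]
  have hvj : 1 < v j ^ 2 * (2 * d * R) ^ 2 := by
    have : τ ^ 2 ≤ (1 / 2) ^ 2 := pow_le_pow_left₀ hτ0.le hτ2 2
    nlinarith
  have hvj0 : v j ≠ 0 := by
    intro h
    rw [h] at hvj
    norm_num at hvj
  have hji : j ≠ i := fun h => hvj0 (h ▸ hv)
  -- Normalizing by `v j` produces a vector with `j`-th entry 1 whose image under `Z` is the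
  -- residual divided by `-v j`, to which the separation of `Z` applies.
  have hZc : Z *ᵥ ((1 / v j) • (v - Pi.single i 1)) = -(1 / v j) • (y - X *ᵥ v) := by
    have h1 : Z *ᵥ v = X *ᵥ v :=
      mulVec_eq_of_apply_eq_zero (fun k l hl => by rw [hZ, if_neg hl]) hv
    have h2 : Z *ᵥ Pi.single i 1 = y := by
      funext k
      rw [Matrix.mulVec_single_one]
      simp [Matrix.col_apply, hZ]
    rw [Matrix.mulVec_smul, Matrix.mulVec_sub, h1, h2, neg_smul, ← smul_neg, neg_sub]
  have h1 := hsep j hji ((1 / v j) • (v - Pi.single i 1)) (by simp [hji, hvj0])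
  rw [hZc, smul_dotProduct, dotProduct_smul] at h1
  simp only [smul_eq_mul] at h1
  have h2 : -(1 / v j) * (-(1 / v j) * ((y - X *ᵥ v) ⬝ᵥ (y - X *ᵥ v))) =
      ((y - X *ᵥ v) ⬝ᵥ (y - X *ᵥ v)) / v j ^ 2 := by field_simp
  rw [h2, le_div_iff₀ (by positivity)] at h1
  have h3 : κ ^ 2 = τ ^ 2 * (2 * d * R) ^ 2 := by rw [hτ, ← mul_pow, div_mul_cancel₀ _ (by positivity)]
  rw [h3] at h1
  nlinarith [sq_nonneg τ]

lemma colSep_of_forall {X : Matrix (Fin n) (Fin d) ℝ} {ρ : ℝ}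
    (h : ∀ j, ∀ c : Fin d → ℝ, c j = 1 → ρ ^ 2 ≤ (X *ᵥ c) ⬝ᵥ (X *ᵥ c)) : ColSep X ρ := by
  intro v i
  by_cases hv : v i = 0
  · rw [hv]
    simpa using dotProduct_self_nonneg_real (X *ᵥ v)
  · have h1 := h i ((1 / v i) • v) (by simp [hv])
    rw [Matrix.mulVec_smul, smul_dotProduct, dotProduct_smul, smul_eq_mul, smul_eq_mul,
      ← mul_assoc, ← sq, one_div, inv_pow, inv_mul_eq_div, le_div_iff₀ (by positivity)] at h1
    exact h1

lemma col_dotProduct_le {X : Matrix (Fin n) (Fin d) ℝ} (hX : ‖X‖ ≤ 1) (j : Fin d) :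
    X.col j ⬝ᵥ X.col j ≤ 1 := by
  have h := Matrix.l2_opNorm_mulVec X (WithLp.toLp 2 (Pi.single j 1))
  have h1 : ‖(WithLp.toLp 2 (X *ᵥ Pi.single j 1) : EuclideanSpace ℝ (Fin n))‖ ≤ 1 := by
    refine h.trans ?_
    simpa using hX
  rw [Matrix.mulVec_single_one] at h1
  have h2 := EuclideanSpace.real_norm_sq_eq (WithLp.toLp 2 (X.col j))
  have h3 : X.col j ⬝ᵥ X.col j = ‖WithLp.toLp 2 (X.col j)‖ ^ 2 := by
    rw [h2]; simp [dotProduct, sq]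
  rw [h3]
  exact pow_le_one₀ (norm_nonneg _) h1

lemma col_add_dotProduct_le {X : Matrix (Fin n) (Fin d) ℝ} (hX : ‖X‖ ≤ 1) {G : Fin n → Fin d → ℝ}
    {T : ℝ} (hG : ∑ k, ∑ j, G k j ^ 2 ≤ T) (j : Fin d) :
    (X + Matrix.of G).col j ⬝ᵥ (X + Matrix.of G).col j ≤ 2 + 2 * T := by
  have h1 : ∑ k, G k j ^ 2 ≤ T := by
    refine le_trans (Finset.sum_le_sum fun k _ => ?_) hG
    exact Finset.single_le_sum (f := fun j => G k j ^ 2) (fun _ _ => sq_nonneg _)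
      (Finset.mem_univ j)
  have h2 : (X + Matrix.of G).col j ⬝ᵥ (X + Matrix.of G).col j ≤
      2 * (X.col j ⬝ᵥ X.col j) + 2 * ∑ k, G k j ^ 2 := by
    simp only [dotProduct, Finset.mul_sum, ← Finset.sum_add_distrib]
    refine Finset.sum_le_sum fun k _ => ?_
    simp only [Matrix.col_apply, Matrix.add_apply, Matrix.of_apply]
    nlinarith [sq_nonneg (X k j - G k j)]
  linarith [col_dotProduct_le hX j]

/-! ### Expected number of small entries. -/

/-- An upper bound for the number of small entries of the regularization path at grid points. -/
noncomputable def smallCount (Xhat : Matrix (Fin n) (Fin d) ℝ) (y : EuclideanSpace ℝ (Fin n))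
    (L l R : ℝ) (J : ℕ) (G : Fin n → Fin d → ℝ) : ℝ≥0∞ :=
  ∑ q ∈ Finset.univ ×ˢ Finset.range (J + 1), (smallEntryEvent Xhat y q.1 (grid l R J q.2)
    (L * (2 * (Real.log (R / l) / J)) * grid l R J q.2) R).indicator 1 G

lemma measurable_smallCount (Xhat : Matrix (Fin n) (Fin d) ℝ) (y : EuclideanSpace ℝ (Fin n))
    (L : ℝ) {l : ℝ} (hl : 0 < l) (R : ℝ) (J : ℕ) : Measurable (smallCount Xhat y L l R J) :=
  Finset.measurable_sum _ fun _ _ => measurable_one.indicator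
    (measurableSet_smallEntryEvent Xhat y _ (grid_pos hl _ _) _ _)

/-- The grid point cancels in each probability, leaving a quantity proportional to `1 / J`; the `d
(J + 1)` terms therefore add up to a bound free of `J`. -/
lemma lintegral_smallCount_le {σ : ℝ} (hσ : 0 < σ) (hn : 0 < n) (Xhat : Matrix (Fin n) (Fin d) ℝ)
    (y : EuclideanSpace ℝ (Fin n)) {L l R : ℝ} (hL : 0 ≤ L) (hl : 0 < l) (hlR : l < R) {J : ℕ}
    (hJ : 0 < J) :
    ∫⁻ G, smallCount Xhat y L l R J G ∂(noise n d σ) ≤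
      ENNReal.ofReal (4 * d * L * Real.log (R / l) * R ^ 3 / (σ / √n)) := by
  have hR : 0 < R := hl.trans hlR
  have hnR : (0 : ℝ) < n := by exact_mod_cast hn
  have hJR : (1 : ℝ) ≤ J := by exact_mod_cast hJ
  have hs : 0 < σ / √n := by positivity
  have hlog : 0 < Real.log (R / l) := Real.log_pos (by rwa [one_lt_div hl])
  unfold smallCount
  rw [lintegral_finsetSum _ fun q _ => measurable_one.indicator
    (measurableSet_smallEntryEvent Xhat y _ (grid_pos hl _ _) _ _)]
  calc _ ≤ ∑ _q ∈ (Finset.univ : Finset (Fin d)) ×ˢ Finset.range (J + 1),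
        ENNReal.ofReal (L * (2 * (Real.log (R / l) / J)) * R ^ 3 / (σ / √n)) := by
        refine Finset.sum_le_sum fun q _ => ?_
        have hg := grid_pos (R := R) hl J q.2
        rw [lintegral_indicator_one (measurableSet_smallEntryEvent Xhat y _ hg _ _)]
        refine (noise_smallEntryEvent_le Xhat y hσ hn q.1 hg (by positivity) hR).trans_eq ?_
        congr 1
        field_simp
    _ = ENNReal.ofReal (d * (J + 1) *
          (L * (2 * (Real.log (R / l) / J)) * R ^ 3 / (σ / √n))) := by
        rw [Finset.sum_const, Finset.card_product, Finset.card_univ, Fintype.card_fin,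
          Finset.card_range, nsmul_eq_mul, ENNReal.ofReal_mul (by positivity),
          ← ENNReal.ofReal_natCast]
        push_cast
        rfl
    _ ≤ _ := by
        refine ENNReal.ofReal_le_ofReal ?_
        rw [mul_div_assoc', div_le_div_iff_of_pos_right hs]
        have e : d * (J + 1) * (L * (2 * (Real.log (R / l) / J)) * R ^ 3) =
          2 * d * L * Real.log (R / l) * R ^ 3 * ((J + 1) / J) := by field_simp
        have h2 : ((J : ℝ) + 1) / J ≤ 2 := by rw [div_le_iff₀ (by linarith)]; linarith
        rw [e]
        calc _ ≤ 2 * d * L * Real.log (R / l) * R ^ 3 * 2 := by gcongr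
          _ = _ := by ring

open Filter in
-- Fatou bounds the expected liminf over `J`, and Markov applies to the liminf. The complement of
-- this event is exactly the frequent bound needed for the count.
lemma noise_eventually_smallCount_ge_le {σ : ℝ} (hσ : 0 < σ) (hn : 0 < n)
    (Xhat : Matrix (Fin n) (Fin d) ℝ) (y : EuclideanSpace ℝ (Fin n)) {L l R K : ℝ} (hL : 0 ≤ L)
    (hl : 0 < l) (hlR : l < R) (hK : 0 < K) :
    noise n d σ {G | ∀ᶠ J in atTop, ENNReal.ofReal K ≤ smallCount Xhat y L l R J G} ≤
      ENNReal.ofReal (4 * d * L * Real.log (R / l) * R ^ 3 / (σ / √n) / K) := by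
  have hmeas := fun J => measurable_smallCount Xhat y L hl R J
  have h1 : ∫⁻ G, liminf (fun J => smallCount Xhat y L l R J G) atTop ∂(noise n d σ) ≤
      ENNReal.ofReal (4 * d * L * Real.log (R / l) * R ^ 3 / (σ / √n)) := by
    refine (lintegral_liminf_le hmeas).trans ?_
    refine liminf_le_of_le (by isBoundedDefault) fun b hb => ?_
    obtain ⟨J, hbJ, hJ⟩ := (hb.and (eventually_gt_atTop 0)).exists
    exact hbJ.trans (lintegral_smallCount_le hσ hn Xhat y hL hl hlR hJ)
  have h2 := mul_meas_ge_le_lintegral (μ := noise n d σ) (Measurable.liminf hmeas)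
    (ENNReal.ofReal K)
  rw [ENNReal.ofReal_div_of_pos hK, ENNReal.le_div_iff_mul_le (Or.inl (by simpa using hK))
    (Or.inl ENNReal.ofReal_ne_top), mul_comm]
  refine le_trans ?_ (h2.trans h1)
  gcongr
  intro hG
  exact le_liminf_of_le (by isBoundedDefault) hG

/-! ### The deterministic conclusion. -/

/-- On the complement of the bad events, the number of segments is controlled. -/
lemma exists_isPath_of_frequently {Xhat : Matrix (Fin n) (Fin d) ℝ} {G : Fin n → Fin d → ℝ}
    {y : EuclideanSpace ℝ (Fin n)} {ρ l R τ K : ℝ} (hy : ‖y‖ = 1) (hρ : 0 < ρ) (hl : 0 < l)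
    (hlR : l < R) (hX : ColSep (Xhat + Matrix.of G) ρ)
    (hcol : ∀ j, (Xhat + Matrix.of G).col j ⬝ᵥ (Xhat + Matrix.of G).col j ≤ R ^ 2)
    (hres : ∀ i, ∀ v : Fin d → ℝ, v i = 0 → τ ^ 2 ≤
      (y.ofLp - (Xhat + Matrix.of G) *ᵥ v) ⬝ᵥ (y.ofLp - (Xhat + Matrix.of G) *ᵥ v))
    (hsmall : ∀ i, G ∉ entryEvent Xhat y i l 0 (d / ρ ^ 2 * l) R τ)
    (hfreq : ∃ᶠ J in Filter.atTop, smallCount Xhat y (d / ρ ^ 2) l R J G < ENNReal.ofReal K) :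
    ∃ w : ℝ → Fin d → ℝ, IsPath (Xhat + Matrix.of G) y w ∧
      numSegments w ≤ ((1 + 2 * ⌈K⌉₊ : ℕ) : ℕ∞) := by
  classical
  have hex : ∀ lam, ∃ w, 0 < lam → IsKKT (Xhat + Matrix.of G) y.ofLp lam w := by
    intro lam
    by_cases h : 0 < lam
    · obtain ⟨w, hw⟩ := exists_isKKT (Xhat + Matrix.of G) y h
      exact ⟨w, fun _ => hw⟩
    · exact ⟨0, fun h' => (h h').elim⟩
  choose w hw using hex
  have hL : 0 ≤ d / ρ ^ 2 := by positivity
  refine ⟨w, (isPath_iff hX hρ).2 hw, numSegments_le_of_frequently hl hlR hL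
    (ordConnected_patternSet hX hρ hw) (isLinearOn_patternSet hX hρ hw)
    (fun a ha b hb i => (hw a ha).lipschitz hX hρ (hw b hb) i) ?_ ?_ ?_⟩
  · intro a ha
    have ha0 : 0 < a := (hl.trans hlR).trans_le ha
    refine ((?_ : IsKKT (Xhat + Matrix.of G) y.ofLp a 0).unique hX hρ (hw a ha0))
    intro i
    refine ⟨?_, by simp⟩
    rw [Matrix.mulVec_zero, sub_zero]
    refine le_trans (abs_le_of_sq_le_sq ?_ (hl.trans hlR).le) ha
    have h1 : ((Xhat + Matrix.of G)ᵀ *ᵥ y.ofLp) i = (Xhat + Matrix.of G).col i ⬝ᵥ y.ofLp := rfl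
    have h2 : ∑ k, y.ofLp k ^ 2 = 1 := by
      rw [← EuclideanSpace.real_norm_sq_eq, hy, one_pow]
    have h3 := Finset.sum_mul_sq_le_sq_mul_sq Finset.univ ((Xhat + Matrix.of G).col i) y.ofLp
    rw [h2, mul_one] at h3
    rw [h1]
    refine h3.trans ?_
    simpa [dotProduct, sq] using hcol i
  · intro i
    by_contra! h
    exact hsmall i ⟨w l, hw l hl, ⟨abs_nonneg _, h⟩, hcol i, hres i⟩
  · refine hfreq.mono fun J hJ => ?_
    have h1 : ((smallEntries w (d / ρ ^ 2) l R J).card : ℝ≥0∞) ≤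
        smallCount Xhat y (d / ρ ^ 2) l R J G := by
      rw [smallEntries, Finset.card_filter, smallCount]
      push_cast
      refine Finset.sum_le_sum fun q _ => ?_
      split_ifs with hq
      · rw [Set.indicator_of_mem]
        · rfl
        · exact ⟨w _, hw _ (grid_pos hl _ _), hq.1, hq.2, hcol _⟩
      · exact zero_le
    have h2 := h1.trans_lt hJ
    have h3 : ((smallEntries w (d / ρ ^ 2) l R J).card : ℝ≥0∞) ≤ (⌈K⌉₊ : ℝ≥0∞) := by
      refine h2.le.trans ?_
      rw [← ENNReal.ofReal_natCast]
      exact ENNReal.ofReal_le_ofReal (Nat.le_ceil K)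
    exact_mod_cast h3

/-! ### Arithmetic of the parameters. -/

lemma log_le_mul_rpow {x Q : ℝ} (hx : 0 < x) (hQ : 1 ≤ Q) (h : x ≤ 10 ^ 8 * Q ^ 13) :
    Real.log x ≤ 202 * Q ^ (0.1 : ℝ) := by
  have hQ0 : 0 < Q := by linarith
  have h1 : Real.log x ≤ 8 * Real.log 10 + 13 * Real.log Q := by
    refine (Real.log_le_log hx h).trans_eq ?_
    rw [Real.log_mul (by positivity) (by positivity), Real.log_pow, Real.log_pow]
    norm_num
  have h2 : Real.log 10 ≤ 9 := by
    have := Real.log_le_sub_one_of_pos (show (0 : ℝ) < 10 by norm_num)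
    linarith
  -- The source of the exponent 0.1; the constant is `8 * 9 + 13 * 10 = 202`.
  have h3 : Real.log Q ≤ Q ^ (0.1 : ℝ) / 0.1 := Real.log_le_rpow_div hQ0.le (by norm_num)
  have h4 : 1 ≤ Q ^ (0.1 : ℝ) := Real.one_le_rpow hQ (by norm_num)
  have h5 : Q ^ (0.1 : ℝ) / 0.1 = 10 * Q ^ (0.1 : ℝ) := by ring
  rw [h5] at h3
  linarith

section Arithmetic

variable {N D σ δ R ρ κ τ l : ℝ}

/-- Only polynomial size matters, since a logarithm follows: each factor is bounded by a power of `Q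
= N / (δσ)`, and the powers add up to 13. -/
lemma div_le_of_params (hD : 1 ≤ D) (hDN : D ≤ N) (hσ : 0 < σ) (hσ1 : σ ≤ 1) (hδ : 0 < δ)
    (hδ1 : δ ≤ 1) (hR0 : 0 < R) (hR : R ^ 2 = 10 * D / δ) (hρ : ρ = δ * σ / (12 * D * √D))
    (hκ : κ = δ * σ / (24 * D ^ 2 * √D)) (hτ : τ = κ / (2 * D * R))
    (hl : l = δ * σ * τ / (8 * D * √N * (1 + D / ρ ^ 2 * R ^ 2))) :
    R / l ≤ 10 ^ 8 * (N / (δ * σ)) ^ 13 := by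
  have hN : 1 ≤ N := hD.trans hDN
  have hD0 : 0 < D := by linarith
  have hN0 : 0 < N := by linarith
  have hδσ : 0 < δ * σ := mul_pos hδ hσ
  have hδσδ : δ * σ ≤ δ := mul_le_of_le_one_right hδ.le hσ1
  have hδσ1 : δ * σ ≤ 1 := hδσδ.trans hδ1
  have hsqD : √D ≤ D := Real.sqrt_le_iff.2 ⟨hD0.le, by nlinarith⟩
  have hsqN : √N ≤ N := Real.sqrt_le_iff.2 ⟨hN0.le, by nlinarith⟩
  set Q := N / (δ * σ) with hQ
  have hNQ : N ≤ Q := by rw [hQ, le_div_iff₀ hδσ]; nlinarith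
  have hQ1 : 1 ≤ Q := hN.trans hNQ
  have hQ0 : 0 < Q := by linarith
  have hDQ : D ≤ Q := hDN.trans hNQ
  have hDQ' : D / (δ * σ) ≤ Q := by rw [hQ]; gcongr
  have hDδ : D / δ ≤ Q := le_trans (by gcongr) hDQ'
  have hRQ : R ≤ 10 * Q := by
    refine abs_le_of_sq_le_sq' ?_ (by positivity) |>.2
    rw [hR, mul_div_assoc]
    nlinarith
  have hR2 : R ^ 2 ≤ 10 * Q := by rw [hR, mul_div_assoc]; linarith
  have hκ' : 1 / κ ≤ 24 * Q ^ 3 := by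
    have e : 1 / κ = 24 * (D / (δ * σ)) * D * √D := by rw [hκ]; field_simp
    rw [e]
    calc 24 * (D / (δ * σ)) * D * √D ≤ 24 * Q * Q * Q := by
          gcongr
          exact hsqD.trans hDQ
      _ = _ := by ring
  have hκ0 : 0 < κ := by rw [hκ]; positivity
  have hτ0 : 0 < τ := by rw [hτ]; positivity
  have hτ' : 1 / τ ≤ 480 * Q ^ 5 := by
    have e : 1 / τ = 2 * D * R * (1 / κ) := by rw [hτ]; field_simp
    rw [e]
    calc 2 * D * R * (1 / κ) ≤ 2 * Q * (10 * Q) * (24 * Q ^ 3) := by gcongr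
      _ = _ := by ring
  have hL : D / ρ ^ 2 ≤ 144 * Q ^ 4 := by
    have e : D / ρ ^ 2 = 144 * D ^ 2 * (D / (δ * σ)) ^ 2 := by
      have hs : √D ^ 2 = D := Real.sq_sqrt hD0.le
      rw [hρ, div_pow, mul_pow _ (√D), hs]
      field_simp
      norm_num
    rw [e]
    calc 144 * D ^ 2 * (D / (δ * σ)) ^ 2 ≤ 144 * Q ^ 2 * Q ^ 2 := by gcongr
      _ = _ := by ring
  have hLR : 1 + D / ρ ^ 2 * R ^ 2 ≤ 1441 * Q ^ 5 := by
    have h1 : (1 : ℝ) ≤ Q ^ 5 := one_le_pow₀ hQ1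
    have h2 : D / ρ ^ 2 * R ^ 2 ≤ 144 * Q ^ 4 * (10 * Q) := by gcongr
    have h3 : 144 * Q ^ 4 * (10 * Q) = 1440 * Q ^ 5 := by ring
    linarith
  have hLR0 : 0 < 1 + D / ρ ^ 2 * R ^ 2 := by positivity
  have e : R / l = R * (8 * (D / (δ * σ)) * √N * (1 + D / ρ ^ 2 * R ^ 2) * (1 / τ)) := by
    rw [hl]
    generalize 1 + D / ρ ^ 2 * R ^ 2 = z at hLR0
    field_simp
  rw [e]
  calc _ ≤ 10 * Q * (8 * Q * Q * (1441 * Q ^ 5) * (480 * Q ^ 5)) := by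
        gcongr
        exact hsqN.trans hNQ
    _ = 55334400 * Q ^ 13 := by ring
    _ ≤ _ := by gcongr; norm_num

lemma count_le_of_params {Λ K : ℝ} (hD : 1 ≤ D) (hDN : D ≤ N) (hσ : 0 < σ) (hσ1 : σ ≤ 1)
    (hδ : 0 < δ) (hδ1 : δ ≤ 1) (hR0 : 0 < R) (hR : R ^ 2 = 10 * D / δ)
    (hρ : ρ = δ * σ / (12 * D * √D))
    (hΛ : Λ ≤ 202 * (N / (δ * σ)) ^ (0.1 : ℝ))
    (hK : K = 4 * (4 * D * (D / ρ ^ 2) * Λ * R ^ 3 / (σ / √N)) / δ) :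
    3 + 2 * K ≤ 4 * 10 ^ 7 * N ^ (1.1 : ℝ) * (D / (δ * σ)) ^ 6 := by
  have hN : 1 ≤ N := hD.trans hDN
  have hD0 : 0 < D := by linarith
  have hN0 : 0 < N := by linarith
  have hδσ : 0 < δ * σ := mul_pos hδ hσ
  have hδσ1 : δ * σ ≤ 1 := mul_le_one₀ hδ1 hσ.le hσ1
  have hsD : √D ^ 2 = D := Real.sq_sqrt hD0.le
  -- Here `D ≤ N` absorbs the `√D` of `R` into `N`, which keeps the power of `D` at 6.
  have hRN : R * √N ≤ 4 * (N / δ) := by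
    refine abs_le_of_sq_le_sq' ?_ (by positivity) |>.2
    rw [mul_pow, Real.sq_sqrt hN0.le, hR, mul_pow, div_pow, mul_div_assoc', div_mul_eq_mul_div,
      div_le_div_iff₀ hδ (by positivity)]
    have h1 : D * N ≤ N ^ 2 := by nlinarith
    have h2 : δ ^ 2 ≤ δ := by nlinarith
    calc 10 * D * N * δ ^ 2 = 10 * (D * N) * δ ^ 2 := by ring
      _ ≤ 16 * N ^ 2 * δ := by gcongr; norm_num
      _ = _ := by ring
  have hQ : (N / (δ * σ)) ^ (0.1 : ℝ) ≤ N ^ (0.1 : ℝ) / (δ * σ) := by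
    rw [Real.div_rpow hN0.le hδσ.le]
    have : δ * σ ≤ (δ * σ) ^ (0.1 : ℝ) := by
      conv_lhs => rw [← Real.rpow_one (δ * σ)]
      exact Real.rpow_le_rpow_of_exponent_ge hδσ hδσ1 (by norm_num)
    gcongr
  have hN11 : N ^ (1.1 : ℝ) = N * N ^ (0.1 : ℝ) := by
    rw [show (1.1 : ℝ) = 1 + 0.1 by norm_num, Real.rpow_add hN0, Real.rpow_one]
  have hP : 1 ≤ N ^ (0.1 : ℝ) := Real.one_le_rpow hN (by norm_num)
  set P := N ^ (0.1 : ℝ)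
  have eK : K = 23040 * (D ^ 6 / (δ ^ 4 * σ ^ 3)) * Λ * (R * √N) := by
    have e1 : R ^ 3 = 10 * D / δ * R := by rw [← hR]; ring
    rw [hK, hρ, div_pow, mul_pow _ (√D), hsD, e1]
    field_simp
    ring
  have hKle : K ≤ 23040 * (D ^ 6 / (δ ^ 4 * σ ^ 3)) * (202 * (P / (δ * σ))) * (4 * (N / δ)) := by
    rw [eK]
    have := hΛ.trans (mul_le_mul_of_nonneg_left hQ (by norm_num))
    gcongr
  have e2 : 23040 * (D ^ 6 / (δ ^ 4 * σ ^ 3)) * (202 * (P / (δ * σ))) * (4 * (N / δ)) =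
      18616320 * (N * P * (D ^ 6 / (δ ^ 6 * σ ^ 4))) := by field_simp; ring
  have h3 : D ^ 6 / (δ ^ 6 * σ ^ 4) ≤ (D / (δ * σ)) ^ 6 := by
    rw [div_pow, mul_pow]
    have : σ ^ 6 ≤ σ ^ 4 := pow_le_pow_of_le_one hσ.le hσ1 (by norm_num)
    gcongr
  have h4 : 1 ≤ (D / (δ * σ)) ^ 6 := by
    refine one_le_pow₀ ?_
    rw [le_div_iff₀ hδσ]
    linarith
  have h5 : 1 ≤ N * P * (D / (δ * σ)) ^ 6 := by
    have := one_le_mul_of_one_le_of_one_le (one_le_mul_of_one_le_of_one_le hN hP) h4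
    exact this
  have h6 : N * P * (D ^ 6 / (δ ^ 6 * σ ^ 4)) ≤ N * P * (D / (δ * σ)) ^ 6 := by gcongr
  rw [hN11]
  rw [e2] at hKle
  linarith

end Arithmetic

/-! ### Assembly: union bound and choice of constants. -/

lemma exists_measurableSet_of_measure_compl_le {Ω : Type*} [MeasurableSpace Ω] {μ : Measure Ω}
    [IsProbabilityMeasure μ] {B : Set Ω} {δ : ℝ} (hB : μ B ≤ ENNReal.ofReal δ) (hδ : 0 ≤ δ) :
    ∃ E, MeasurableSet E ∧ ENNReal.ofReal (1 - δ) ≤ μ E ∧ ∀ x ∈ E, x ∉ B := by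
  refine ⟨(toMeasurable μ B)ᶜ, (measurableSet_toMeasurable μ B).compl, ?_,
    fun x hx hxB => hx (subset_toMeasurable μ B hxB)⟩
  rw [prob_compl_eq_one_sub (measurableSet_toMeasurable μ B), measure_toMeasurable,
    ENNReal.ofReal_sub _ hδ, ENNReal.ofReal_one]
  exact tsub_le_tsub_left hB 1

lemma measure_iUnion_fin_le {Ω : Type*} [MeasurableSpace Ω] {μ : Measure Ω} {m : ℕ}
    {B : Fin m → Set Ω} {c : ℝ} (hB : ∀ i, μ (B i) ≤ ENNReal.ofReal c) :
    μ (⋃ i, B i) ≤ ENNReal.ofReal (m * c) := by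
  refine (measure_iUnion_fintype_le μ B).trans ((Finset.sum_le_sum fun i _ => hB i).trans_eq ?_)
  rw [Finset.sum_const, Finset.card_univ, Fintype.card_fin, nsmul_eq_mul,
    ENNReal.ofReal_mul (by positivity), ENNReal.ofReal_natCast]

end Lasso

open Lasso in
theorem theorem1 :
    ∃ C : ℝ, 0 < C ∧
      ∀ (n d : ℕ), 1 ≤ d → d ≤ n →
      ∀ (σ : ℝ), 0 < σ → σ ≤ 1 →
      ∀ (Xhat : Matrix (Fin n) (Fin d) ℝ), ‖Xhat‖ ≤ 1 →
      ∀ (y : EuclideanSpace ℝ (Fin n)), ‖y‖ = 1 →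
      ∀ (δ : ℝ), 0 < δ →
        ∃ E : Set (Fin n → Fin d → ℝ), MeasurableSet E ∧
          ENNReal.ofReal (1 - δ) ≤ Lasso.noise n d σ E ∧
          ∀ G ∈ E, ∃ w : ℝ → Fin d → ℝ,
            Lasso.IsPath (Xhat + Matrix.of G) y w ∧
            (Lasso.numSegments w : ℝ≥0∞) ≤
              ENNReal.ofReal (C * (n : ℝ) ^ (1.1 : ℝ) * ((d : ℝ) / (δ * σ)) ^ 6) := by
  refine ⟨4 * 10 ^ 7, by norm_num, fun n d hd hdn σ hσ hσ1 Xhat hXhat y hy δ hδ => ?_⟩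
  rcases le_or_gt 1 δ with hδ1 | hδ1
  · exact ⟨∅, MeasurableSet.empty, by simp [hδ1], fun G hG => hG.elim⟩
  have hn : 0 < n := by omega
  have hD : (1 : ℝ) ≤ d := by exact_mod_cast hd
  have hDN : (d : ℝ) ≤ n := by exact_mod_cast hdn
  have hD0 : (0 : ℝ) < d := by linarith
  have hN0 : (0 : ℝ) < n := by linarith
  have hsD : 0 < √(d : ℝ) := Real.sqrt_pos.2 hD0
  have hsD1 : 1 ≤ √(d : ℝ) := Real.one_le_sqrt.2 hD
  have hsN1 : 1 ≤ √(n : ℝ) := Real.one_le_sqrt.2 (hD.trans hDN)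
  have hδσ1 : δ * σ ≤ 1 := mul_le_one₀ hδ1.le hσ.le hσ1
  have hDδ : 1 ≤ d / δ := by rw [le_div_iff₀ hδ]; linarith
  -- The parameters are fixed by the union bound. `R ^ 2` dominates `2 + 2 * (4d/δ)`, the column
  -- bound off `B1`; `ρ`, `κ`, `l` and `K` give the unions of `B2`, `B3`, `B4` and the event `B5`
  -- probabilities at most `δ/4`, `δ/8`, `δ/8` and `δ/4`.
  obtain ⟨R, hR⟩ : ∃ R : ℝ, R = √(10 * d / δ) := ⟨_, rfl⟩
  have hR0 : 0 < R := by rw [hR]; positivity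
  have hR2 : R ^ 2 = 10 * d / δ := by rw [hR, Real.sq_sqrt (by positivity)]
  have hR1 : 1 < R := by
    refine (one_lt_sq_iff₀ hR0.le).1 ?_
    rw [hR2, mul_div_assoc]
    linarith
  obtain ⟨ρ, hρ⟩ : ∃ ρ : ℝ, ρ = δ * σ / (12 * d * √d) := ⟨_, rfl⟩
  have hρ0 : 0 < ρ := by rw [hρ]; positivity
  obtain ⟨κ, hκ⟩ : ∃ κ : ℝ, κ = δ * σ / (24 * d ^ 2 * √d) := ⟨_, rfl⟩
  have hκ0 : 0 < κ := by rw [hκ]; positivity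
  have hκ1 : κ ≤ 1 := by
    rw [hκ]
    refine div_le_one_of_le₀ (hδσ1.trans ?_) (by positivity)
    have : 1 ≤ (d : ℝ) ^ 2 := one_le_pow₀ hD
    nlinarith
  obtain ⟨τ, hτ⟩ : ∃ τ : ℝ, τ = κ / (2 * d * R) := ⟨_, rfl⟩
  have hτ0 : 0 < τ := by rw [hτ]; positivity
  have hτ1 : τ ≤ 1 := by
    rw [hτ]
    exact div_le_one_of_le₀ (hκ1.trans (by nlinarith)) (by positivity)
  obtain ⟨l, hl⟩ : ∃ l : ℝ, l = δ * σ * τ / (8 * d * √n * (1 + d / ρ ^ 2 * R ^ 2)) := ⟨_, rfl⟩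
  have hz : 1 ≤ 1 + d / ρ ^ 2 * R ^ 2 := le_add_of_nonneg_right (by positivity)
  have hl0 : 0 < l := by rw [hl]; positivity
  have hl1 : l ≤ 1 := by
    rw [hl]
    refine div_le_one_of_le₀ ((mul_le_one₀ hδσ1 hτ0.le hτ1).trans ?_) (by positivity)
    exact one_le_mul_of_one_le_of_one_le
      (one_le_mul_of_one_le_of_one_le (by linarith) hsN1) hz
  have hlR : l < R := hl1.trans_lt hR1
  have hΛ0 : 0 < Real.log (R / l) := Real.log_pos (by rwa [one_lt_div hl0])
  have hΛ : Real.log (R / l) ≤ 202 * (n / (δ * σ)) ^ (0.1 : ℝ) := by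
    refine log_le_mul_rpow (by positivity) ?_
      (div_le_of_params hD hDN hσ hσ1 hδ hδ1.le hR0 hR2 hρ hκ hτ hl)
    rw [le_div_iff₀ (by positivity)]
    linarith
  obtain ⟨K, hK⟩ : ∃ K : ℝ, K =
    4 * (4 * d * (d / ρ ^ 2) * Real.log (R / l) * R ^ 3 / (σ / √n)) / δ := ⟨_, rfl⟩
  have hK0 : 0 < K := by rw [hK]; positivity
  have hcount := count_le_of_params hD hDN hσ hσ1 hδ hδ1.le hR0 hR2 hρ hΛ hK
  set Y : Fin d → (Fin n → Fin d → ℝ) → Matrix (Fin n) (Fin d) ℝ := fun i G =>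
    Matrix.of fun k m => if m = i then y.ofLp k else Xhat k m + G k m with hY
  set B1 : Set (Fin n → Fin d → ℝ) := {G | 4 * d / δ < ∑ k, ∑ j, G k j ^ 2} with hB1
  set B2 : Fin d → Set (Fin n → Fin d → ℝ) := fun j => {G | ∃ c : Fin d → ℝ, c j = 1 ∧
    ((Xhat + Matrix.of G) *ᵥ c) ⬝ᵥ ((Xhat + Matrix.of G) *ᵥ c) < ρ ^ 2} with hB2
  set B3 : Fin d → Fin d → Set (Fin n → Fin d → ℝ) := fun i j => {G | j ≠ i ∧
    ∃ c : Fin d → ℝ, c j = 1 ∧ (Y i G *ᵥ c) ⬝ᵥ (Y i G *ᵥ c) < κ ^ 2} with hB3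
  set B4 : Fin d → Set (Fin n → Fin d → ℝ) := fun i =>
    entryEvent Xhat y i l 0 (d / ρ ^ 2 * l) R τ with hB4
  set B5 : Set (Fin n → Fin d → ℝ) := {G | ∀ᶠ J in Filter.atTop,
    ENNReal.ofReal K ≤ smallCount Xhat y (d / ρ ^ 2) l R J G} with hB5
  have m1 : noise n d σ B1 ≤ ENNReal.ofReal (δ / 4) := by
    refine (noise_sum_sq_gt_le hn (by positivity)).trans (ENNReal.ofReal_le_ofReal ?_)
    have e : d * σ ^ 2 / (4 * d / δ) = δ / 4 * σ ^ 2 := by field_simp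
    rw [e]
    exact mul_le_of_le_one_right (by positivity) (pow_le_one₀ hσ.le hσ1)
  have m2 : noise n d σ (⋃ j, B2 j) ≤ ENNReal.ofReal (δ / 4) := by
    refine (measure_iUnion_fin_le fun j => noise_exists_mulVec_small_le hσ hd hdn j (Xhat.col j)
      (Φ := fun G => Xhat + Matrix.of G) (t := ρ) ?_ ?_ ?_ hρ0.le).trans_eq ?_
    · intro k m
      simp only [Matrix.add_apply, Matrix.of_apply]
      fun_prop
    · intro G k; rfl
    · intro G x k m hm
      simp [hm]
    · congr 1
      rw [hρ]
      field_simp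
      norm_num
  have m3 : noise n d σ (⋃ i, ⋃ j, B3 i j) ≤ ENNReal.ofReal (δ / 8) := by
    refine (measure_iUnion_fin_le fun i => measure_iUnion_fin_le
      (c := 3 * κ * √d / σ) fun j => ?_).trans_eq ?_
    · by_cases hji : j = i
      · have : B3 i j = ∅ := by
          ext G
          exact ⟨fun h => h.1 hji, fun h => h.elim⟩
        rw [this, measure_empty]
        exact zero_le
      · refine (measure_mono fun G hG => hG.2).trans
          (noise_exists_mulVec_small_le hσ hd hdn j (Xhat.col j)
            (Φ := Y i) (t := κ) ?_ ?_ ?_ hκ0.le)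
        · intro k m
          simp only [hY, Matrix.of_apply]
          split_ifs <;> fun_prop
        · intro G k
          simp [hY, hji]
        · intro G x k m hm
          simp [hY, hm]
    · congr 1
      rw [hκ]
      field_simp
      norm_num
  have m4 : noise n d σ (⋃ i, B4 i) ≤ ENNReal.ofReal (δ / 8) := by
    refine (measure_iUnion_fin_le fun i => noise_entryEvent_le Xhat y hσ hn i hl0
      (by positivity) hτ0).trans_eq ?_
    congr 1
    have e : l + d / ρ ^ 2 * l * R ^ 2 = l * (1 + d / ρ ^ 2 * R ^ 2) := by ring
    rw [e, hl]
    have hz0 : 0 < 1 + d / ρ ^ 2 * R ^ 2 := by linarith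
    generalize 1 + d / ρ ^ 2 * R ^ 2 = z at hz0
    have : 0 < √(n : ℝ) := by linarith
    field_simp
  have m5 : noise n d σ B5 ≤ ENNReal.ofReal (δ / 4) := by
    refine (noise_eventually_smallCount_ge_le hσ hn Xhat y (by positivity) hl0 hlR hK0).trans_eq ?_
    congr 1
    rw [hK]
    have : 0 < 4 * d * (d / ρ ^ 2) * Real.log (R / l) * R ^ 3 / (σ / √n) := by positivity
    generalize 4 * d * (d / ρ ^ 2) * Real.log (R / l) * R ^ 3 / (σ / √n) = M at this
    field_simp
  have hbad : noise n d σ (B1 ∪ (⋃ j, B2 j) ∪ (⋃ i, ⋃ j, B3 i j) ∪ (⋃ i, B4 i) ∪ B5) ≤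
      ENNReal.ofReal δ := by
    have e : δ = δ / 4 + δ / 4 + δ / 8 + δ / 8 + δ / 4 := by ring
    rw [e, ENNReal.ofReal_add (by positivity) (by positivity),
      ENNReal.ofReal_add (by positivity) (by positivity),
      ENNReal.ofReal_add (by positivity) (by positivity),
      ENNReal.ofReal_add (by positivity) (by positivity)]
    have h2 := (measure_union_le B1 (⋃ j, B2 j)).trans (add_le_add m1 m2)
    have h3 := (measure_union_le _ (⋃ i, ⋃ j, B3 i j)).trans (add_le_add h2 m3)
    have h4 := (measure_union_le _ (⋃ i, B4 i)).trans (add_le_add h3 m4)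
    exact (measure_union_le _ B5).trans (add_le_add h4 m5)
  obtain ⟨E, hE, hEm, hEB⟩ := exists_measurableSet_of_measure_compl_le hbad hδ.le
  refine ⟨E, hE, hEm, fun G hG => ?_⟩
  have hG := hEB G hG
  simp only [Set.mem_union, not_or, Set.mem_iUnion, not_exists] at hG
  obtain ⟨⟨⟨⟨g1, g2⟩, g3⟩, g4⟩, g5⟩ := hG
  have hcol : ∀ j, (Xhat + Matrix.of G).col j ⬝ᵥ (Xhat + Matrix.of G).col j ≤ R ^ 2 := by
    intro j
    refine (col_add_dotProduct_le hXhat (not_lt.1 g1) j).trans ?_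
    rw [hR2, mul_div_assoc, mul_div_assoc]
    linarith
  have hsep : ColSep (Xhat + Matrix.of G) ρ := colSep_of_forall fun j c hc => by
    by_contra! h
    exact g2 j ⟨c, hc, h⟩
  have hyy : y.ofLp ⬝ᵥ y.ofLp = 1 := by
    have := EuclideanSpace.real_norm_sq_eq y
    rw [hy, one_pow] at this
    simpa [dotProduct, sq] using this.symm
  obtain ⟨w, hw, hseg⟩ := exists_isPath_of_frequently (K := K) (τ := τ) hy hρ0 hl0 hlR hsep hcol
    (fun i v hv => by
      rw [hτ]
      refine le_residual_of_colSep (Z := Y i G) hyy hR0 hκ0 (hκ1.trans (by nlinarith)) hcol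
        (fun k m => rfl) (fun j hji c hc => ?_) hv
      by_contra! h
      exact g3 i j ⟨hji, c, hc, h⟩)
    g4 ((Filter.not_eventually.1 g5).mono fun J hJ => not_le.1 hJ)
  refine ⟨w, hw, ?_⟩
  have h1 : (numSegments w : ℝ≥0∞) ≤ ((1 + 2 * ⌈K⌉₊ : ℕ) : ℝ≥0∞) := by
    exact_mod_cast ENat.toENNReal_le.2 hseg
  refine h1.trans ?_
  rw [← ENNReal.ofReal_natCast]
  -- Rounding up costs 2: `1 + 2⌈K⌉ ≤ 3 + 2K`.
  refine ENNReal.ofReal_le_ofReal (le_trans ?_ hcount)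
  have := (Nat.ceil_lt_add_one hK0.le).le
  push_cast
  linarith
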